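/- For a group $G$, let $\mathrm{Th}_\forall(G)$ be its universal theory, i.e. the set of all first-order sentences $\forall x_1\cdots\forall x_n\,\varphi(x_1,\dots,x_n)$ in the language of groups, with $\varphi$ quantifier-free, that hold in $G$. A group $G$ is *equationally Noetherian* if for every $n$ every set $S$ of equations $w=1$ with $w\in G*F(x_1,\dots,x_n)$ has a finite subset with the same solution set in $G^n$ as $S$. The *Krull dimension* of a finitely generated equationally Noetherian group $G$ is the largest integer $k\ge 0$ such that there is a chain of surjective homomorphisms $G=Q_0\to Q_1\to\dots\to Q_k$ in which each $Q_{i+1}$ is a proper quotient of $Q_i$ (the map $Q_i\to Q_{i+1}$ has non-trivial kernel) and $\mathrm{Th}_\forall(Q_i)=\mathrm{Th}_\forall(G)$ for all $i$. Let $F$ be the free group on $a,b$, let $c=[a,b]=aba^{-1}b^{-1}$ and $L=\mathbb Z[x^{\pm1},y^{\pm1}]$. For $Q=\sum\beta_{ij}x^iy^j\in L$ put $c^{Q(a,b)}=\prod_{i,j}(a^ib^j)c^{\beta_{ij}}(a^ib^j)^{-1}\in F$ (product in the lexicographical order of $\mathbb Z^2$). For an ideal $\mathfrak a\subseteq L$,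 let $M(\mathfrak a)$ be the quotient of $F$ by the normal closure of $F''\cup\{c^{Q(a,b)}:Q\in\mathfrak a\}$. For $\lambda\in\mathbb C\setminus\{0\}$ let $G(\lambda)=\mathbb Z[\lambda^{\pm1}]\rtimes\mathbb Z$, where $a=1\in\mathbb Z$ acts on $\mathbb Z[\lambda^{\pm1}]$ by multiplication by $\lambda$, and let $b\in G(\lambda)$ be the element $1\in\mathbb Z[\lambda^{\pm1}]$. Let $P_\lambda\in\mathbb Z[x]$ be the minimal polynomial of $\lambda$ over $\mathbb Z$ (the irreducible polynomial in $\mathbb Z[x]$ with positive leading coefficient that vanishes at $\lambda$) if $\lambda$ is algebraic, and $P_\lambda=0$ if $\lambda$ is transcendental. Put $M(\lambda)=M(\Phi_m(x),y-1)$ if $\lambda$ is a primitive $m$-th root of unity, where $\Phi_m$ is the $m$-th cyclotomic polynomial, and $M(\lambda)=M(P_\lambda(x))$ if $\lambda$ is not a root of unity. Let $\lambda\in\mathbb C\setminus\{0,1\}$. Then $M(\lambda)$ is finitely generated and equationally Noetherian, and its Krull dimension is $1$. Moreover, $a\mapsto a$, $b\mapsto b$ defines a surjective homomorphism $M(\lambda)\to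 G(\lambda)$ with non-trivial kernel, and $G(\lambda)$ has the same universal theory as $M(\lambda)$, so that $M(\lambda)\to G(\lambda)$ is a chain of maximal length; and every chain $M(\lambda)=Q_0\to Q_1$ as above of this maximal length satisfies $Q_1\cong G(\lambda)$. -/

import Mathlib

namespace KrullML

/-! ### Universal theory of a group -/

/-- Function symbols of the first-order language of groups. -/
inductive GroupFunc : ℕ → Type
  | one : GroupFunc 0
  | inv : GroupFunc 1
  | mul : GroupFunc 2

/-- The first-order language of groups `{1, ⁻¹, ·}` (equality is a logical symbol). -/
def groupLang : FirstOrder.Language.{0, 0} where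
  Functions := GroupFunc
  Relations := fun _ => Empty

instance groupStructure (G : Type*) [Group G] : groupLang.Structure G where
  funMap := fun {_} f =>
    match f with
    | GroupFunc.one => fun _ => 1
    | GroupFunc.inv => fun v => (v 0)⁻¹
    | GroupFunc.mul => fun v => v 0 * v 1
  RelMap := fun {_} r => Empty.elim r

/-- The set of all universal sentences `∀ x₁ … ∀ xₙ, φ(x₁, …, xₙ)`, with `φ` quantifier-free,
that hold in `G`. -/
def universalTheory (G : Type*) [Group G] : groupLang.Theory :=
  {σ | FirstOrder.Language.BoundedFormula.IsUniversal σ ∧ G ⊨ σ}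

/-! ### Equationally Noetherian groups and Krull dimension -/

/-- The value of `w ∈ G * F(x₁, …, xₙ)` (an equation with coefficients in `G`) at a point
`v ∈ Gⁿ`. -/
def evalEq {G : Type*} [Group G] {n : ℕ} (v : Fin n → G) :
    Monoid.Coprod G (FreeGroup (Fin n)) →* G :=
  Monoid.Coprod.lift (MonoidHom.id G) (FreeGroup.lift v)

/-- `G` is equationally Noetherian: every system of equations in finitely many unknowns with
coefficients in `G` has the same solutions in `G` as one of its finite subsystems. -/
def IsEquationallyNoetherian (G : Type*) [Group G] : Prop :=
  ∀ (n : ℕ) (S : Set (Monoid.Coprod G (FreeGroup (Fin n)))),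
    ∃ S₀ : Finset (Monoid.Coprod G (FreeGroup (Fin n))), (S₀ : Set _) ⊆ S ∧
      ∀ v : Fin n → G, (∀ w ∈ S₀, evalEq v w = 1) → ∀ w ∈ S, evalEq v w = 1

/-- A chain `G = Q₀ → Q₁ → ⋯ → Q_k` of surjective homomorphisms in which every `Q_{i+1}` is a
proper quotient of `Q_i` and every `Q_i` has the same universal theory as `G`. -/
structure QuotientChain (G : Type) [Group G] (k : ℕ) where
  Q : Fin (k + 1) → Type
  [group : ∀ i, Group (Q i)]
  start : Q 0 ≃* G
  map : ∀ i : Fin k, Q i.castSucc →* Q i.succ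
  surjective : ∀ i, Function.Surjective (map i)
  proper : ∀ i, (map i).ker ≠ ⊥
  theory_eq : ∀ i, universalTheory (Q i) = universalTheory G

attribute [instance] QuotientChain.group

/-- `G` is a finitely generated equationally Noetherian group and its Krull dimension, the largest
length of a chain as above, exists and is `k`. -/
def HasKrullDimension (G : Type) [Group G] (k : ℕ) : Prop :=
  Group.FG G ∧ IsEquationallyNoetherian G ∧
    IsGreatest {n : ℕ | Nonempty (QuotientChain G n)} k

/-! ### The groups `M(𝔞)` -/

/-- The free group on two generators. -/
abbrev F : Type := FreeGroup (Fin 2)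

def fa : F := FreeGroup.of 0
def fb : F := FreeGroup.of 1

/-- The Laurent polynomial ring `L = ℤ[x^{±1}, y^{±1}]`, as the group ring of `ℤ²`. -/
abbrev L : Type := AddMonoidAlgebra ℤ (ℤ × ℤ)

noncomputable def Lx : L := AddMonoidAlgebra.single (1, 0) 1
noncomputable def Ly : L := AddMonoidAlgebra.single (0, 1) 1

/-- For `Q = ∑ β_{ij} x^i y^j`, the element
`c^{Q(a,b)} = ∏_{i,j} (a^i b^j) c^{β_{ij}} (a^i b^j)⁻¹` of `F`, where `c = [a, b] = a b a⁻¹ b⁻¹`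
and the product is taken in the lexicographical order of `ℤ²`. -/
noncomputable def commPow (Q : L) : F :=
  (((Q.coeff.support.map toLex.toEmbedding).sort (· ≤ ·)).map fun p : ℤ ×ₗ ℤ =>
    fa ^ (ofLex p).1 * fb ^ (ofLex p).2 * (fa * fb * fa⁻¹ * fb⁻¹) ^ Q.coeff (ofLex p) *
      (fa ^ (ofLex p).1 * fb ^ (ofLex p).2)⁻¹).prod

/-- `M(𝔞)`: the quotient of the free metabelian group `F / F''` by the ideal `𝔞` of `L`, the derived
subgroup of `F / F''` being identified with `L` in such a way that `Q ∈ L` corresponds to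
`c^{Q(a,b)}`. -/
abbrev MGroup (I : Ideal L) : Type :=
  PresentedGroup ((derivedSeries F 2 : Set F) ∪ {w | ∃ Q ∈ I, w = commPow Q})

/-! ### The groups `G(λ)` and `M(λ)` -/

open Classical in
/-- The minimal polynomial `P_λ` of `λ` over `ℤ`: the unique irreducible `P ∈ ℤ[x]` with positive
leading coefficient vanishing at `λ` if `λ` is algebraic, and `0` if `λ` is transcendental. -/
noncomputable def minPolyZ (lam : ℂ) : Polynomial ℤ :=
  if h : ∃ P : Polynomial ℤ, Irreducible P ∧ 0 < P.leadingCoeff ∧ Polynomial.aeval lam P = 0 then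
    h.choose
  else 0

open Classical in
/-- The ideal defining `M(λ)`: it is `(Φ_m(x), y - 1)` if `λ` is a primitive `m`-th root of unity,
and `(P_λ(x))` if `λ` is not a root of unity. -/
noncomputable def MlamIdeal (lam : ℂˣ) : Ideal L :=
  if IsOfFinOrder lam then
    Ideal.span {Polynomial.aeval Lx (Polynomial.cyclotomic (orderOf lam) ℤ), Ly - 1}
  else Ideal.span {Polynomial.aeval Lx (minPolyZ lam)}

/-- The group `M(λ)`. -/
abbrev Mlam (lam : ℂˣ) : Type := MGroup (MlamIdeal lam)

/-- The generators `a`, `b` of `M(λ)`. -/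
def Mlam.a (lam : ℂˣ) : Mlam lam := PresentedGroup.of 0
def Mlam.b (lam : ℂˣ) : Mlam lam := PresentedGroup.of 1

/-- The ring `ℤ[λ^{±1}] ⊆ ℂ`. -/
abbrev Rlam (lam : ℂˣ) : Type :=
  Algebra.adjoin ℤ ({(lam : ℂ), ((lam⁻¹ : ℂˣ) : ℂ)} : Set ℂ)

/-- `λ` as a unit of `ℤ[λ^{±1}]`. -/
def Rlam.unit (lam : ℂˣ) : (Rlam lam)ˣ where
  val := ⟨lam, Algebra.subset_adjoin (by simp)⟩
  inv := ⟨(lam⁻¹ : ℂˣ), Algebra.subset_adjoin (by simp)⟩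
  val_inv := Subtype.ext (by simp)
  inv_val := Subtype.ext (by simp)

/-- The action of `ℤ` on the additive group of `ℤ[λ^{±1}]` in which `1` acts by multiplication
by `λ`. -/
def lamAction (lam : ℂˣ) : Multiplicative ℤ →* MulAut (Multiplicative (Rlam lam)) :=
  (MulAutMultiplicative (Rlam lam)).symm.toMonoidHom.comp
    ((DistribMulAction.toAddAut (Rlam lam)ˣ (Rlam lam)).comp
      (zpowersHom (Rlam lam)ˣ (Rlam.unit lam)))

/-- The group `G(λ) = ℤ[λ^{±1}] ⋊ ℤ`. -/
abbrev Glam (lam : ℂˣ) : Type :=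
  Multiplicative (Rlam lam) ⋊[lamAction lam] Multiplicative ℤ

/-- The generators of `G(λ)`: `a` is the generator `1` of `ℤ` and `b` is the unity of
`ℤ[λ^{±1}]`. -/
def Glam.a (lam : ℂˣ) : Glam lam := SemidirectProduct.inr (Multiplicative.ofAdd 1)
def Glam.b (lam : ℂˣ) : Glam lam := SemidirectProduct.inl (Multiplicative.ofAdd 1)

end KrullML

namespace KrullML

open FirstOrder FirstOrder.Language

/-! ### Universal theories and residual properties -/

/-! The derived subgroup of `F / F''` is a cyclic module over `L` generated by `c`, so every element
of `M(λ)` has the form `a^p b^q c^Q`. If a homomorphism to `G(λ)` maps `a`, `b` to elements over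
`i`, `j ∈ ℤ`, then the image of `c^Q` is that of `c` scaled by `Q(λ^i, λ^j)` (`lin_map_commPow`).
Questions about homomorphisms thus become questions about the points `(λ^i, λ^j)` at which Laurent
polynomials vanish.

Same universal theory: let `m` be the order of `λ`, or `1` if this is infinite. The maps `a ↦ a`, `b
↦ b a^(mk)` factor through `M(λ)`, and a non-trivial element is killed by only finitely many of them
(`finite_setOf_shiftHom_eq_one`), so `M(λ)` is fully residually `G(λ)`. Conversely, the pair `a`,
`c` generates a copy of `G(λ)` in `M(λ)`. Being linear over `ℂ`, `G(λ)` is equationally Noetherian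
by Hilbert's basis theorem, and the finitely generated, residually `G(λ)` group `M(λ)` inherits
this.

Quotients: a proper quotient `N` with the same universal theory is fully residually `G(λ)`, because
`G(λ)` is equationally Noetherian. Some non-trivial `a^p b^q c^Q` dies in `N`, and this leaves only
finitely many types of exponents `(i, j)` for the homomorphisms from `N` to `G(λ)` with non-abelian
image (`exists_finite_types`); homomorphisms of one type have the same kernel
(`eq_one_of_sameType`). If none were injective, a non-trivial element could be picked from the
kernel of each type, and no homomorphism would keep all of these and `c` away from `1`. So `N`
embeds in `G(λ)`. The Euclidean algorithm on exponents yields generators `γ`, `β` of `N` with `β`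
over `0` and `γ` over some `g` such that `λ^g` satisfies the same integral polynomials as `λ`; by
`ker_homF_eq` they satisfy the same relations as `a`, `b` in `G(λ)`, whence `N ≅ G(λ)`. A chain of
length two would therefore contain a non-injective surjection between two copies of `G(λ)`, which is
Hopfian. -/

/-- Every finite set of non-trivial elements of `N` is kept away from `1` by a homomorphism to
`H`. -/
def IsFullyResidually (N H : Type*) [Group N] [Group H] : Prop :=
  ∀ E : Finset N, 1 ∉ E → ∃ ψ : N →* H, ∀ e ∈ E, ψ e ≠ 1

/-- The term is chosen before the group, so one formula expresses the equation in two different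
groups. -/
theorem exists_term_realize_eq_lift {n : ℕ} (w : FreeGroup (Fin n)) :
    ∃ t : groupLang.Term (Empty ⊕ Fin n), ∀ (G : Type) [Group G] (v : Fin n → G),
      t.realize (Sum.elim default v) = FreeGroup.lift v w := by
  induction w using FreeGroup.induction_on with
  | C1 =>
    exact ⟨Term.func (L := groupLang) GroupFunc.one Fin.elim0, fun G _ v => by
      rw [map_one]; rfl⟩
  | of i => exact ⟨Term.var (Sum.inr i), fun G _ v => by simp⟩
  | inv_of i _ =>
    exact ⟨Term.func (L := groupLang) GroupFunc.inv ![Term.var (Sum.inr i)], fun G _ v => by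
      rw [map_inv, FreeGroup.lift_apply_of]; rfl⟩
  | mul x y hx hy =>
    obtain ⟨s, hs⟩ := hx
    obtain ⟨t, ht⟩ := hy
    refine ⟨Term.func (L := groupLang) GroupFunc.mul ![s, t], fun G _ v => ?_⟩
    rw [map_mul, ← hs, ← ht]; rfl

theorem isQF_foldr_inf {n : ℕ} (l : List (groupLang.BoundedFormula Empty n))
    (h : ∀ φ ∈ l, φ.IsQF) : (l.foldr (· ⊓ ·) ⊤).IsQF := by
  induction l with
  | nil => exact BoundedFormula.IsQF.top
  | cons φ l ih =>
    exact (h φ (by simp)).inf (ih fun ψ hψ => h ψ (by simp [hψ]))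

theorem isUniversal_alls {n : ℕ} {φ : groupLang.BoundedFormula Empty n}
    (h : φ.IsUniversal) : BoundedFormula.IsUniversal φ.alls := by
  induction n with
  | zero => exact h
  | succ n ih => exact ih h.all

/-- A finite system of equations and inequations solvable in `N` is solvable in every group whose
universal theory is contained in that of `N`. -/
theorem exists_solution_of_universalTheory_subset {N H : Type} [Group N] [Group H]
    (h : universalTheory H ⊆ universalTheory N) {n : ℕ} (E₀ E₁ : Finset (FreeGroup (Fin n)))
    (v : Fin n → N) (h₀ : ∀ w ∈ E₀, FreeGroup.lift v w = 1)
    (h₁ : ∀ w ∈ E₁, FreeGroup.lift v w ≠ 1) :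
    ∃ v' : Fin n → H, (∀ w ∈ E₀, FreeGroup.lift v' w = 1) ∧
      ∀ w ∈ E₁, FreeGroup.lift v' w ≠ 1 := by
  classical
  choose t ht using exists_term_realize_eq_lift (n := n)
  let eqn : FreeGroup (Fin n) → groupLang.BoundedFormula Empty n := fun w =>
    (t w).bdEqual (t 1)
  have heqn : ∀ w, (eqn w).IsQF := fun w => (BoundedFormula.IsAtomic.equal _ _).isQF
  have hreal : ∀ (G : Type) [Group G] (u : Fin n → G) (w : FreeGroup (Fin n)),
      (eqn w).Realize default u ↔ FreeGroup.lift u w = 1 := by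
    intro G _ u w
    simp only [eqn, BoundedFormula.realize_bdEqual]
    rw [ht, ht, map_one]
  let φ : groupLang.BoundedFormula Empty n :=
    (E₀.toList.map eqn).foldr (· ⊓ ·) ⊤ ⊓ (E₁.toList.map fun w => (eqn w).not).foldr (· ⊓ ·) ⊤
  have hφ : φ.IsQF := by
    refine BoundedFormula.IsQF.inf (isQF_foldr_inf _ ?_) (isQF_foldr_inf _ ?_)
    · intro ψ hψ
      obtain ⟨w, -, rfl⟩ := List.mem_map.1 hψ
      exact heqn w
    · intro ψ hψ
      obtain ⟨w, -, rfl⟩ := List.mem_map.1 hψ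
      exact (heqn w).not
  have hφr : ∀ (G : Type) [Group G] (u : Fin n → G), φ.Realize default u ↔
      (∀ w ∈ E₀, FreeGroup.lift u w = 1) ∧ ∀ w ∈ E₁, FreeGroup.lift u w ≠ 1 := by
    intro G _ u
    simp [φ, BoundedFormula.realize_inf, BoundedFormula.realize_foldr_inf, hreal]
  -- Without a solution in `H`, the universal closure of `¬φ` belongs to the theory of `H`, hence to
  -- that of `N`, where `v` refutes it.
  by_contra hcon
  push Not at hcon
  have hmem : φ.not.alls ∈ universalTheory H := by
    refine ⟨isUniversal_alls hφ.not.isUniversal, ?_⟩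
    refine BoundedFormula.realize_alls.2 fun u hu => ?_
    obtain ⟨w, hw, hw'⟩ := hcon u ((hφr H u).1 hu).1
    exact ((hφr H u).1 hu).2 w hw hw'
  exact BoundedFormula.realize_alls.1 (h hmem).2 v ((hφr N v).2 ⟨h₀, h₁⟩)

theorem realize_term_map {N H : Type} [Group N] [Group H] (ψ : N →* H) {α : Type}
    (t : groupLang.Term α) (v : α → N) : t.realize (fun i => ψ (v i)) = ψ (t.realize v) := by
  induction t with
  | var i => rfl
  | @func l f ts ih =>
    simp only [Term.realize, ih]
    cases f with
    | one => exact (map_one ψ).symm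
    | inv => exact (map_inv ψ _).symm
    | mul => exact (map_mul ψ _ _).symm

/-- A homomorphism preserves every true equation. The truth value can change only when a false
equation `s = t` becomes true, so `E` collects the elements `s t⁻¹` of the finitely many false
atoms. -/
theorem exists_finset_realize_iff {N : Type} (H : Type) [Group N] [Group H] {n : ℕ}
    {φ : groupLang.BoundedFormula Empty n} (hφ : φ.IsQF) (v : Fin n → N) :
    ∃ E : Finset N, 1 ∉ E ∧ ∀ ψ : N →* H, (∀ e ∈ E, ψ e ≠ 1) →
      (φ.Realize default (fun i => ψ (v i)) ↔ φ.Realize default v) := by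
  classical
  induction hφ with
  | falsum => exact ⟨∅, by simp, fun ψ _ => Iff.rfl⟩
  | of_isAtomic h =>
    cases h with
    | rel R ts => exact R.elim
    | equal s t =>
      have key : ∀ (ψ : N →* H) (t : groupLang.Term (Empty ⊕ Fin n)),
          t.realize (Sum.elim default fun i => ψ (v i)) =
            ψ (t.realize (Sum.elim default v)) := by
        intro ψ t
        rw [← realize_term_map]
        congr 1
        funext i
        rcases i with i | i
        · exact i.elim
        · rfl
      by_cases hst : s.realize (Sum.elim default v) = t.realize (Sum.elim default v)
      · refine ⟨∅, by simp, fun ψ _ => ?_⟩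
        simp only [BoundedFormula.realize_bdEqual, key, hst]
      · refine ⟨{(s.realize (Sum.elim default v)) * (t.realize (Sum.elim default v))⁻¹}, ?_,
          fun ψ hψ => ?_⟩
        · rwa [Finset.mem_singleton, eq_comm, mul_inv_eq_one]
        · have := hψ _ (Finset.mem_singleton_self _)
          simp only [BoundedFormula.realize_bdEqual, key, hst, iff_false]
          rwa [map_mul, map_inv, Ne, mul_inv_eq_one] at this
  | imp _ _ ih₁ ih₂ =>
    obtain ⟨E₁, hE₁, h₁⟩ := ih₁
    obtain ⟨E₂, hE₂, h₂⟩ := ih₂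
    refine ⟨E₁ ∪ E₂, by simp [hE₁, hE₂], fun ψ hψ => ?_⟩
    rw [BoundedFormula.realize_imp, BoundedFormula.realize_imp,
      h₁ ψ fun e he => hψ e (Finset.mem_union_left _ he),
      h₂ ψ fun e he => hψ e (Finset.mem_union_right _ he)]

/-- The hypothesis ranges over all `E` because the set that is finally needed depends on the values
given to the quantified variables. -/
theorem realize_of_isUniversal {N H : Type} [Group N] [Group H] {n : ℕ}
    {φ : groupLang.BoundedFormula Empty n} (hφ : φ.IsUniversal) (v : Fin n → N)
    (h : ∀ E : Finset N, 1 ∉ E → ∃ ψ : N →* H, (∀ e ∈ E, ψ e ≠ 1) ∧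
      φ.Realize default (fun i => ψ (v i))) : φ.Realize default v := by
  induction hφ with
  | of_isQF hφ =>
    obtain ⟨E, hE, h'⟩ := exists_finset_realize_iff H hφ v
    obtain ⟨ψ, hψ, hr⟩ := h E hE
    exact (h' ψ hψ).1 hr
  | all _ ih =>
    intro x
    refine ih _ fun E hE => ?_
    obtain ⟨ψ, hψ, hr⟩ := h E hE
    refine ⟨ψ, hψ, ?_⟩
    convert hr (ψ x) using 1
    funext i
    refine Fin.lastCases ?_ (fun i => ?_) i <;> simp

theorem IsFullyResidually.universalTheory_subset {N H : Type} [Group N] [Group H]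
    (h : IsFullyResidually N H) : universalTheory H ⊆ universalTheory N := by
  rintro σ ⟨hu, hσ⟩
  refine ⟨hu, realize_of_isUniversal (H := H) hu default fun E hE => ?_⟩
  obtain ⟨ψ, hψ⟩ := h E hE
  refine ⟨ψ, hψ, ?_⟩
  rwa [Subsingleton.elim (fun i : Fin 0 => ψ ((default : Fin 0 → N) i)) default]

theorem isFullyResidually_of_injective {N H : Type*} [Group N] [Group H] (f : N →* H)
    (hf : Function.Injective f) : IsFullyResidually N H :=
  fun _ hE => ⟨f, fun _ he h => hE ((map_eq_one_iff f hf).1 h ▸ he)⟩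

end KrullML
namespace KrullML

/-! ### Equationally Noetherian groups -/

theorem evalEq_inr {G : Type*} [Group G] {n : ℕ} (v : Fin n → G) (w : FreeGroup (Fin n)) :
    evalEq v (Monoid.Coprod.inr w) = FreeGroup.lift v w :=
  Monoid.Coprod.lift_apply_inr _ _ _

theorem evalEq_inl {G : Type*} [Group G] {n : ℕ} (v : Fin n → G) (g : G) :
    evalEq v (Monoid.Coprod.inl g) = g :=
  Monoid.Coprod.lift_apply_inl _ _ _

/-- A group of matrices over a commutative Noetherian ring is equationally Noetherian. -/
theorem isEquationallyNoetherian_of_injective_matrix {G : Type*} [Group G] {m : Type*} [Fintype m]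
    [DecidableEq m] {A : Type*} [CommRing A] [IsNoetherianRing A] (ρ : G →* Matrix m m A)
    (hρ : Function.Injective ρ) : IsEquationallyNoetherian G := by
  classical
  intro n S
  let gen : Fin n × Bool × m × m → (Fin n → G) → A := fun x v =>
    ρ (if x.2.1 then v x.1 else (v x.1)⁻¹) x.2.2.1 x.2.2.2
  -- The entries of `w(v)` are polynomial in the entries of the `v i` and their inverses. The
  -- functions of `v` generated by these coordinates form a Noetherian ring by Hilbert's basis
  -- theorem.
  let B : Subalgebra A ((Fin n → G) → A) := Algebra.adjoin A (Set.range gen)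
  have hB : IsNoetherianRing B :=
    isNoetherianRing_of_fg (Subalgebra.fg_def.2 ⟨_, Set.finite_range gen, rfl⟩)
  have hfree : ∀ (x : FreeGroup (Fin n)) (p q : m), (fun v => ρ (FreeGroup.lift v x) p q) ∈ B := by
    intro x
    induction x using FreeGroup.induction_on with
    | C1 =>
      intro p q
      simp only [map_one]
      exact B.algebraMap_mem ((1 : Matrix m m A) p q)
    | of i =>
      intro p q
      simpa [gen] using Algebra.subset_adjoin (R := A) (Set.mem_range_self (f := gen) (i, true, p, q))
    | inv_of i _ =>
      intro p q
      simpa [gen] using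
        Algebra.subset_adjoin (R := A) (Set.mem_range_self (f := gen) (i, false, p, q))
    | mul x y hx hy =>
      intro p q
      have : (fun v => ρ (FreeGroup.lift v (x * y)) p q) =
          ∑ j, (fun v => ρ (FreeGroup.lift v x) p j) * (fun v => ρ (FreeGroup.lift v y) j q) := by
        funext v
        simp [Matrix.mul_apply]
      rw [this]
      exact B.sum_mem fun j _ => B.mul_mem (hx p j) (hy j q)
  have hmem : ∀ (w : Monoid.Coprod G (FreeGroup (Fin n))) (p q : m),
      (fun v => ρ (evalEq v w) p q) ∈ B := by
    intro w
    induction w using Monoid.Coprod.induction_on with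
    | inl g =>
      intro p q
      simp only [evalEq_inl]
      exact B.algebraMap_mem (ρ g p q)
    | inr x => simpa only [evalEq_inr] using hfree x
    | mul x y hx hy =>
      intro p q
      have : (fun v => ρ (evalEq v (x * y)) p q) =
          ∑ j, (fun v => ρ (evalEq v x) p j) * (fun v => ρ (evalEq v y) j q) := by
        funext v
        simp [Matrix.mul_apply]
      rw [this]
      exact B.sum_mem fun j _ => B.mul_mem (hx p j) (hy j q)
  let f : Monoid.Coprod G (FreeGroup (Fin n)) × m × m → B := fun x =>
    ⟨fun v => ρ (evalEq v x.1) x.2.1 x.2.2 - (1 : Matrix m m A) x.2.1 x.2.2,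
      B.sub_mem (hmem x.1 x.2.1 x.2.2) (B.algebraMap_mem ((1 : Matrix m m A) x.2.1 x.2.2))⟩
  have hf : ∀ (v : Fin n → G) (w : Monoid.Coprod G (FreeGroup (Fin n))),
      evalEq v w = 1 ↔ ∀ p q, (f (w, p, q) : (Fin n → G) → A) v = 0 := by
    intro v w
    rw [← map_eq_one_iff ρ hρ, ← Matrix.ext_iff]
    simp [f, sub_eq_zero]
  obtain ⟨T, hTS, hT⟩ := (Submodule.fg_span_iff_fg_span_finset_subset
    (f '' {x | x.1 ∈ S})).1 (IsNoetherian.noetherian (Ideal.span (f '' {x | x.1 ∈ S})))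
  choose c hcS hc using hTS
  refine ⟨T.attach.image fun t => (c t.2).1, ?_, fun v hv w hw => ?_⟩
  · intro w hw
    obtain ⟨t, -, rfl⟩ := Finset.mem_image.1 (Finset.mem_coe.1 hw)
    exact hcS t.2
  -- The common zeros of a set of functions are those of the ideal it generates, as evaluation at
  -- `v` is a ring homomorphism.
  · let ev : B →+* A := (Pi.evalRingHom (fun _ => A) v).comp B.val.toRingHom
    have hle : Ideal.span (T : Set B) ≤ RingHom.ker ev := by
      rw [Ideal.span_le]
      intro t ht
      have h1 := (hf v (c ht).1).1 (hv _ (Finset.mem_image_of_mem _ (Finset.mem_attach T ⟨t, ht⟩)))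
        (c ht).2.1 (c ht).2.2
      change (f (c ht) : (Fin n → G) → A) v = 0 at h1
      rw [hc ht] at h1
      exact h1
    rw [hf]
    intro p q
    refine hle (x := f (w, p, q)) ?_
    change f (w, p, q) ∈ Submodule.span B (T : Set B)
    rw [← hT]
    exact Submodule.subset_span ⟨(w, p, q), hw, rfl⟩

/-- The coefficient-free case of the definition. -/
theorem IsEquationallyNoetherian.exists_finset {H : Type*} [Group H]
    (hH : IsEquationallyNoetherian H) {n : ℕ} (S : Set (FreeGroup (Fin n))) :
    ∃ S₀ : Finset (FreeGroup (Fin n)), (S₀ : Set _) ⊆ S ∧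
      ∀ v : Fin n → H, (∀ w ∈ S₀, FreeGroup.lift v w = 1) → ∀ w ∈ S, FreeGroup.lift v w = 1 := by
  classical
  obtain ⟨T, hTS, hT⟩ := hH n (Monoid.Coprod.inr '' S)
  choose! c hcS hc using hTS
  refine ⟨T.image c, ?_, fun v hv w hw => ?_⟩
  · intro w hw
    obtain ⟨t, ht, rfl⟩ := Finset.mem_image.1 (Finset.mem_coe.1 hw)
    exact hcS ht
  · rw [← evalEq_inr]
    refine hT v (fun t ht => ?_) _ ⟨w, hw, rfl⟩
    rw [← hc ht, evalEq_inr]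
    exact hv _ (Finset.mem_image_of_mem _ ht)

theorem exists_freeGroup_fin_surjective (M : Type*) [Group M] [Group.FG M] :
    ∃ (k : ℕ) (v : Fin k → M), Function.Surjective (FreeGroup.lift v) := by
  obtain ⟨S, hS⟩ := Group.fg_iff.1 ‹Group.FG M›
  obtain ⟨k, v, hv⟩ := hS.2.fin_param
  refine ⟨k, v, ?_⟩
  rw [← MonoidHom.range_eq_top, FreeGroup.range_lift_eq_closure, hv.2, hS.1]

/-- A finitely generated group that is residually an equationally Noetherian group is
equationally Noetherian. -/
theorem IsEquationallyNoetherian.of_residually {M H : Type*} [Group M] [Group H] [Group.FG M]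
    (hH : IsEquationallyNoetherian H) (hres : ∀ x : M, x ≠ 1 → ∃ ψ : M →* H, ψ x ≠ 1) :
    IsEquationallyNoetherian M := by
  classical
  intro n S
  obtain ⟨k, u, hu⟩ := exists_freeGroup_fin_surjective M
  -- The coefficients in `M` become words in `k` additional variables, to be evaluated at the
  -- generators `u`. This gives a coefficient-free system, which a homomorphism `ψ` can carry to
  -- `H`; its finite subsystem serves every `ψ` at once.
  let q : FreeGroup (Fin (k + n)) →* Monoid.Coprod M (FreeGroup (Fin n)) :=
    FreeGroup.lift (Fin.append (fun i => Monoid.Coprod.inl (u i))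
      fun j => Monoid.Coprod.inr (FreeGroup.of j))
  have hq : Function.Surjective q := by
    intro w
    induction w using Monoid.Coprod.induction_on with
    | inl g =>
      obtain ⟨x, rfl⟩ := hu g
      refine ⟨FreeGroup.map (Fin.castAdd n) x, ?_⟩
      have : q.comp (FreeGroup.map (Fin.castAdd n)) =
          Monoid.Coprod.inl.comp (FreeGroup.lift u) := by
        ext i; simp [q]
      exact DFunLike.congr_fun this x
    | inr x =>
      refine ⟨FreeGroup.map (Fin.natAdd k) x, ?_⟩
      have : q.comp (FreeGroup.map (Fin.natAdd k)) = Monoid.Coprod.inr := by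
        ext i; simp [q]
      exact DFunLike.congr_fun this x
    | mul x y hx hy =>
      obtain ⟨x', rfl⟩ := hx
      obtain ⟨y', rfl⟩ := hy
      exact ⟨x' * y', map_mul _ _ _⟩
  have hev : ∀ (v : Fin n → M) (x : FreeGroup (Fin (k + n))),
      evalEq v (q x) = FreeGroup.lift (Fin.append u v) x := by
    intro v x
    have : (evalEq v).comp q = FreeGroup.lift (Fin.append u v) := by
      ext i
      refine Fin.addCases (fun i => ?_) (fun i => ?_) i <;> simp [q, evalEq_inl, evalEq_inr]
    exact DFunLike.congr_fun this x
  obtain ⟨T, hTS, hT⟩ := hH.exists_finset (q ⁻¹' S)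
  refine ⟨T.image q, ?_, fun v hv w hw => ?_⟩
  · intro w hw
    obtain ⟨t, ht, rfl⟩ := Finset.mem_image.1 (Finset.mem_coe.1 hw)
    exact hTS ht
  · obtain ⟨x, rfl⟩ := hq w
    have hψ : ∀ (ψ : M →* H) (x : FreeGroup (Fin (k + n))),
        FreeGroup.lift (fun i => ψ (Fin.append u v i)) x = ψ (evalEq v (q x)) := by
      intro ψ x
      rw [hev]
      have : FreeGroup.lift (fun i => ψ (Fin.append u v i)) =
          ψ.comp (FreeGroup.lift (Fin.append u v)) := by
        ext i; simp
      exact DFunLike.congr_fun this x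
    by_contra hne
    obtain ⟨ψ, hne⟩ := hres _ hne
    refine hne ?_
    rw [← hψ]
    refine hT _ (fun t ht => ?_) x hw
    rw [hψ, hv _ (Finset.mem_image_of_mem _ ht), map_one]

/-- A finitely generated group whose universal theory contains that of an equationally Noetherian
group `H` is fully residually `H`. -/
theorem IsEquationallyNoetherian.isFullyResidually {N H : Type} [Group N] [Group H] [Group.FG N]
    (hH : IsEquationallyNoetherian H) (h : universalTheory H ⊆ universalTheory N) :
    IsFullyResidually N H := by
  classical
  intro E hE
  obtain ⟨k, u, hu⟩ := exists_freeGroup_fin_surjective N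
  -- `N` need not be finitely presented, but finitely many of its relations imply all the others in
  -- `H`. A solution of these in `H` is therefore a homomorphism from `N`.
  obtain ⟨T, hTS, hT⟩ := hH.exists_finset {w | FreeGroup.lift u w = 1}
  choose c hc using hu
  obtain ⟨v, hv₀, hv₁⟩ := exists_solution_of_universalTheory_subset h T (E.image c) u
    (fun w hw => hTS hw) (by
      intro w hw
      obtain ⟨e, he, rfl⟩ := Finset.mem_image.1 hw
      rw [hc]
      rintro rfl
      exact hE he)
  have hker : (FreeGroup.lift u).ker ≤ (FreeGroup.lift v).ker := fun w hw =>
    hT v hv₀ w hw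
  refine ⟨(FreeGroup.lift u).liftOfRightInverse c hc ⟨FreeGroup.lift v, hker⟩, fun e he => ?_⟩
  rw [← hc e, MonoidHom.liftOfRightInverse_comp_apply]
  exact hv₁ _ (Finset.mem_image_of_mem _ he)

/-- Finitely generated equationally Noetherian groups are Hopfian. -/
theorem IsEquationallyNoetherian.injective_of_surjective {H : Type*} [Group H] [Group.FG H]
    (hH : IsEquationallyNoetherian H) (f : H →* H) (hf : Function.Surjective f) :
    Function.Injective f := by
  obtain ⟨k, u, hu⟩ := exists_freeGroup_fin_surjective H
  have hpow : ∀ (n : ℕ) (x : FreeGroup (Fin k)),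
      FreeGroup.lift (fun i => f^[n] (u i)) x = f^[n] (FreeGroup.lift u x) := by
    intro n x
    induction n with
    | zero => rfl
    | succ n ih =>
      have : FreeGroup.lift (fun i => f^[n + 1] (u i)) =
          f.comp (FreeGroup.lift fun i => f^[n] (u i)) := by
        ext i; simp [Function.iterate_succ_apply']
      rw [this, MonoidHom.comp_apply, ih, Function.iterate_succ_apply']
  -- The words killed by some iterate of `f` form a system equivalent to a finite one, so a single
  -- iterate `f^[m]` kills them all. If `g = f^[m] g'` and `f g = 1`, then a word for `g'` is among
  -- them, and `g = 1`.
  obtain ⟨T, hTS, hT⟩ := hH.exists_finset {w | ∃ n, f^[n] (FreeGroup.lift u w) = 1}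
  have hmono : ∀ (n m : ℕ) (h : H), n ≤ m → f^[n] h = 1 → f^[m] h = 1 := by
    intro n m h hnm hn
    obtain ⟨d, rfl⟩ := Nat.exists_eq_add_of_le' hnm
    rw [Function.iterate_add_apply, hn]
    exact iterate_map_one f d
  choose! c hc using hTS
  let m := T.sup c
  rw [injective_iff_map_eq_one]
  intro g hg
  obtain ⟨g', rfl⟩ := hf.iterate m g
  obtain ⟨w, rfl⟩ := hu g'
  rw [← hpow]
  refine hT _ (fun t ht => ?_) w ⟨m + 1, ?_⟩
  · rw [hpow]
    exact hmono _ _ _ (Finset.le_sup ht) (hc ht)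
  · rw [Function.iterate_succ_apply', hg]

end KrullML
namespace KrullML

open Polynomial

/-! ### Evaluations of Laurent polynomials -/

/-- The evaluation `Q ↦ Q(u, v)`. -/
noncomputable def ev (u v : ℂˣ) : L →ₐ[ℤ] ℂ :=
  AddMonoidAlgebra.lift ℤ ℂ (ℤ × ℤ)
    { toFun := fun p => ((u ^ p.toAdd.1 * v ^ p.toAdd.2 : ℂˣ) : ℂ)
      map_one' := by simp
      map_mul' := fun p q => by simp [zpow_add]; ring }

theorem ev_single (u v : ℂˣ) (i j n : ℤ) :
    ev u v (AddMonoidAlgebra.single (i, j) n) = n * ((u ^ i * v ^ j : ℂˣ) : ℂ) := by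
  simp [ev]

theorem eq_sum_single (Q : L) :
    Q = ∑ p ∈ Q.coeff.support, AddMonoidAlgebra.single p (Q.coeff p) :=
  (AddMonoidAlgebra.sum_coeff_single Q).symm

theorem ev_eq_sum (u v : ℂˣ) (Q : L) :
    ev u v Q = ∑ p ∈ Q.coeff.support, (Q.coeff p : ℂ) * ((u ^ p.1 * v ^ p.2 : ℂˣ) : ℂ) := by
  conv_lhs => rw [eq_sum_single Q, map_sum]
  exact Finset.sum_congr rfl fun p _ => ev_single u v p.1 p.2 _

theorem ev_Lx (u v : ℂˣ) : ev u v Lx = u := by simp [Lx, ev_single]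

theorem ev_Ly (u v : ℂˣ) : ev u v Ly = v := by simp [Ly, ev_single]

theorem ev_aeval_Lx (u v : ℂˣ) (p : ℤ[X]) : ev u v (aeval Lx p) = aeval (u : ℂ) p := by
  rw [← aeval_algHom_apply, ev_Lx]

theorem Lx_pow_mul (k : ℕ) (n : ℤ) :
    aeval Lx (C n * X ^ k : ℤ[X]) = AddMonoidAlgebra.single ((k : ℤ), 0) n := by
  rw [map_mul, map_pow, aeval_X, aeval_C, Lx, AddMonoidAlgebra.single_pow, eq_intCast,
    ← zsmul_one, smul_mul_assoc, one_mul, AddMonoidAlgebra.smul_single]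
  simp

/-! ### Minimal polynomials over `ℤ` -/

/-- `P` generates the ideal of integral polynomials that vanish at `u`. -/
def IsMinRoot (P : ℤ[X]) (u : ℂˣ) : Prop :=
  ∀ p : ℤ[X], aeval (u : ℂ) p = 0 ↔ P ∣ p

theorem IsMinRoot.aeval_eq_zero {P : ℤ[X]} {u : ℂˣ} (h : IsMinRoot P u) :
    aeval (u : ℂ) P = 0 := (h P).2 dvd_rfl

/-- By Gauss's lemma `P` is primitive and stays irreducible over `ℚ`. If `P ∤ p`, a Bézout relation
over `ℚ` evaluated at `u` would give `0 = 1`. -/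
theorem isMinRoot_of_irreducible {P : ℤ[X]} (hP : Irreducible P) {u : ℂˣ}
    (hu : aeval (u : ℂ) P = 0) : IsMinRoot P u := by
  have hdeg : P.natDegree ≠ 0 := by
    intro h
    rw [natDegree_eq_zero] at h
    obtain ⟨c, rfl⟩ := h
    rw [aeval_C, eq_intCast, Int.cast_eq_zero] at hu
    rw [hu, C_0] at hP
    exact hP.ne_zero rfl
  have hprim := hP.isPrimitive hdeg
  have hirr := (IsPrimitive.Int.irreducible_iff_irreducible_map_cast hprim).1 hP
  have haev : ∀ p : ℤ[X], aeval (u : ℂ) (p.map (Int.castRingHom ℚ)) = aeval (u : ℂ) p := by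
    intro p
    rw [← algebraMap_int_eq, aeval_map_algebraMap]
  intro p
  constructor
  · intro hp
    rw [IsPrimitive.Int.dvd_iff_map_cast_dvd_map_cast _ _ hprim]
    by_contra hdvd
    obtain ⟨r, t, hrt⟩ := hirr.coprime_iff_not_dvd.2 hdvd
    have := congrArg (aeval (u : ℂ)) hrt
    rw [map_add, map_mul, map_mul, haev, haev, hu, hp, map_one] at this
    simp at this
  · rintro ⟨q, rfl⟩
    rw [map_mul, hu, zero_mul]

theorem isMinRoot_cyclotomic {m : ℕ} (hm : 0 < m) {u : ℂˣ} (hu : orderOf u = m) :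
    IsMinRoot (cyclotomic m ℤ) u := by
  refine isMinRoot_of_irreducible (cyclotomic.irreducible hm) ?_
  have : IsPrimitiveRoot (u : ℂ) m :=
    IsPrimitiveRoot.coe_units_iff.2 (hu ▸ IsPrimitiveRoot.orderOf u)
  have h := this.isRoot_cyclotomic hm
  rwa [IsRoot, ← map_cyclotomic_int, eval_map, ← algebraMap_int_eq, ← aeval_def] at h

theorem orderOf_of_aeval_cyclotomic {m : ℕ} (hm : 0 < m) {u : ℂˣ}
    (hu : aeval (u : ℂ) (cyclotomic m ℤ) = 0) : orderOf u = m := by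
  have : NeZero (m : ℂ) := ⟨by exact_mod_cast hm.ne'⟩
  have h : IsRoot (cyclotomic m ℂ) (u : ℂ) := by
    rwa [IsRoot, ← map_cyclotomic_int, eval_map, ← algebraMap_int_eq, ← aeval_def]
  have h' := IsPrimitiveRoot.coe_units_iff.1 (isRoot_cyclotomic_iff.1 h)
  exact h'.eq_orderOf.symm

theorem exists_irreducible_of_aeval_eq_zero {u : ℂ} {p : ℤ[X]} (hp : p ≠ 0)
    (hu : aeval u p = 0) :
    ∃ P : ℤ[X], Irreducible P ∧ 0 < P.leadingCoeff ∧ aeval u P = 0 := by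
  obtain ⟨P, hP, hPu⟩ : ∃ P : ℤ[X], Irreducible P ∧ aeval u P = 0 := by
    induction p using WfDvdMonoid.induction_on_irreducible with
    | zero => exact absurd rfl hp
    | unit q hq =>
      obtain ⟨r, hr, rfl⟩ := isUnit_iff.1 hq
      rw [aeval_C, eq_intCast, Int.cast_eq_zero] at hu
      simp [hu] at hr
    | mul q i hq hi ih =>
      rw [map_mul, mul_eq_zero] at hu
      exact hu.elim (fun h => ⟨i, hi, h⟩) fun h => ih hq h
  rcases lt_or_gt_of_ne (leadingCoeff_ne_zero.2 hP.ne_zero) with h | h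
  · exact ⟨-P, (Associated.refl P).neg_left.symm.irreducible hP, by simpa using h, by simpa using hPu⟩
  · exact ⟨P, hP, h, hPu⟩

/-- The transcendental case fits the same pattern with `P = 0`, since `0 ∣ p` means `p = 0`. -/
theorem minPolyZ_spec (lam : ℂˣ) :
    IsMinRoot (minPolyZ lam) lam ∧ (minPolyZ lam = 0 ∨ Irreducible (minPolyZ lam)) := by
  rw [minPolyZ]
  split_ifs with h
  · exact ⟨isMinRoot_of_irreducible h.choose_spec.1 h.choose_spec.2.2, Or.inr h.choose_spec.1⟩
  · refine ⟨fun p => ?_, Or.inl rfl⟩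
    rw [zero_dvd_iff]
    refine ⟨fun hp => ?_, fun hp => by simp [hp]⟩
    by_contra hne
    exact h (exists_irreducible_of_aeval_eq_zero hne hp)

/-- Multiplication by a high power of `u` clears the negative exponents and leaves a polynomial
relation, hence a multiple of `P`. The exponents `f t` may repeat. -/
theorem IsMinRoot.sum_single_mem {P : ℤ[X]} {u : ℂˣ} (h : IsMinRoot P u) {ι : Type*}
    (s : Finset ι) (β f : ι → ℤ) (hs : ∑ t ∈ s, (β t : ℂ) * ((u ^ f t : ℂˣ) : ℂ) = 0) :
    ∑ t ∈ s, (AddMonoidAlgebra.single (f t, 0) (β t) : L) ∈ Ideal.span {aeval Lx P} := by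
  obtain ⟨N, hN⟩ : ∃ N : ℤ, ∀ t ∈ s, 0 ≤ f t + N :=
    ⟨∑ t ∈ s, |f t|, fun t ht => by
      have := Finset.single_le_sum (f := fun t => |f t|) (fun i _ => abs_nonneg _) ht
      have := neg_abs_le (f t)
      linarith⟩
  let p : ℤ[X] := ∑ t ∈ s, C (β t) * X ^ (f t + N).toNat
  have hp : aeval (u : ℂ) p = 0 := by
    have : aeval (u : ℂ) p = ((u ^ N : ℂˣ) : ℂ) * ∑ t ∈ s, (β t : ℂ) * ((u ^ f t : ℂˣ) : ℂ) := by
      simp only [p, map_sum, map_mul, map_pow, aeval_X, aeval_C, Finset.mul_sum, algebraMap_int_eq,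
        Int.coe_castRingHom]
      refine Finset.sum_congr rfl fun t ht => ?_
      rw [← Units.val_pow_eq_pow_val, ← zpow_natCast, Int.toNat_of_nonneg (hN t ht), zpow_add,
        Units.val_mul]
      ring
    rw [this, hs, mul_zero]
  have hL : ∑ t ∈ s, (AddMonoidAlgebra.single (f t, 0) (β t) : L) =
      AddMonoidAlgebra.single (-N, 0) 1 * aeval Lx p := by
    simp only [p, map_sum, Finset.mul_sum]
    refine Finset.sum_congr rfl fun t ht => ?_
    rw [Lx_pow_mul, Int.toNat_of_nonneg (hN t ht), AddMonoidAlgebra.single_mul_single]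
    simp
  rw [hL]
  obtain ⟨q, hq⟩ := (h p).1 hp
  rw [hq, map_mul]
  exact Ideal.mul_mem_left _ _ (Ideal.mul_mem_right _ _ (Ideal.mem_span_singleton_self _))

/-- Modulo `y - 1` every monomial `x^i y^j` becomes `x^i`, which leaves a relation between powers of
`u` alone. -/
theorem IsMinRoot.ev_one_eq_zero_iff {P : ℤ[X]} {u : ℂˣ} (h : IsMinRoot P u) (Q : L) :
    ev u 1 Q = 0 ↔ Q ∈ Ideal.span {aeval Lx P, Ly - 1} := by
  constructor
  · intro hQ
    rw [ev_eq_sum] at hQ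
    simp only [one_zpow, mul_one] at hQ
    have h1 := h.sum_single_mem _ (fun p => Q.coeff p) (fun p : ℤ × ℤ => p.1) hQ
    have h2 : ∀ (i j n : ℤ), (AddMonoidAlgebra.single (i, j) n : L) -
        AddMonoidAlgebra.single (i, 0) n ∈ Ideal.span {aeval Lx P, Ly - 1} := by
      intro i j n
      have hu : ∀ j : ℤ, (AddMonoidAlgebra.single (0, j) 1 : L) - 1 ∈
          Ideal.span {aeval Lx P, Ly - 1} := by
        intro j
        rw [← Ideal.Quotient.eq_zero_iff_mem, map_sub, map_one, sub_eq_zero]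
        have hy : Ideal.Quotient.mk (Ideal.span {aeval Lx P, Ly - 1})
            (AddMonoidAlgebra.single (0, 1) 1) = 1 := by
          rw [← map_one (Ideal.Quotient.mk _), Ideal.Quotient.eq]
          exact Ideal.subset_span (by simp [Ly])
        induction j using Int.induction_on with
        | zero => exact map_one _
        | succ j ih =>
          have : (AddMonoidAlgebra.single (0, (j : ℤ) + 1) 1 : L) =
            AddMonoidAlgebra.single (0, (j : ℤ)) 1 * AddMonoidAlgebra.single (0, 1) 1 := by
              rw [AddMonoidAlgebra.single_mul_single]; simp
          rw [this, map_mul, ih, hy, one_mul]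
        | pred j ih =>
          have : (AddMonoidAlgebra.single (0, -(j : ℤ)) 1 : L) =
            AddMonoidAlgebra.single (0, -(j : ℤ) - 1) 1 * AddMonoidAlgebra.single (0, 1) 1 := by
              rw [AddMonoidAlgebra.single_mul_single]; simp
          rwa [this, map_mul, hy, mul_one] at ih
      have := Ideal.mul_mem_left _ (AddMonoidAlgebra.single (i, 0) n) (hu j)
      rw [mul_sub, mul_one, AddMonoidAlgebra.single_mul_single] at this
      simpa using this
    have h3 : Q = ∑ p ∈ Q.coeff.support, ((AddMonoidAlgebra.single p (Q.coeff p) : L) -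
        AddMonoidAlgebra.single (p.1, 0) (Q.coeff p)) +
        ∑ p ∈ Q.coeff.support, (AddMonoidAlgebra.single (p.1, 0) (Q.coeff p) : L) := by
      rw [Finset.sum_sub_distrib, sub_add_cancel, ← eq_sum_single]
    rw [h3]
    refine Ideal.add_mem _ (Ideal.sum_mem _ fun p _ => h2 p.1 p.2 _) ?_
    exact Ideal.span_mono (by simp) h1
  · intro hQ
    have : Ideal.span {aeval Lx P, Ly - 1} ≤ RingHom.ker (ev u 1).toRingHom := by
      rw [Ideal.span_le]
      rintro q (rfl | rfl)
      · exact (ev_aeval_Lx u 1 P).trans h.aeval_eq_zero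
      · change ev u 1 (Ly - 1) = 0
        rw [map_sub, ev_Ly, map_one]; simp
    exact this hQ

theorem zpow_injective_of_not_isOfFinOrder {v : ℂˣ} (hv : ¬IsOfFinOrder v) :
    Function.Injective fun k : ℤ => v ^ k :=
  injective_zpow_iff_not_isOfFinOrder.2 hv

/-- A Laurent polynomial that vanishes at `(u, v ^ k)` for infinitely many `k`. -/
theorem IsMinRoot.mem_span_of_infinite {P : ℤ[X]} {u v : ℂˣ} (h : IsMinRoot P u)
    (hv : ¬IsOfFinOrder v) (Q : L) (hQ : {k : ℤ | ev u (v ^ k) Q = 0}.Infinite) :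
    Q ∈ Ideal.span {aeval Lx P} := by
  classical
  let s := Q.coeff.support
  obtain ⟨N, hN⟩ : ∃ N : ℤ, ∀ t ∈ s, 0 ≤ t.2 + N :=
    ⟨∑ t ∈ s, |t.2|, fun t ht => by
      have := Finset.single_le_sum (f := fun t : ℤ × ℤ => |t.2|) (fun i _ => abs_nonneg _) ht
      have := neg_abs_le t.2
      linarith⟩
  -- This is `y^N Q(u, y)` as a polynomial in `y`. The `v ^ k` are distinct, so it has infinitely
  -- many roots and is zero; each of its coefficients is then a Laurent polynomial in `x` vanishing
  -- at `u`.
  let p : ℂ[X] := ∑ t ∈ s, C ((Q.coeff t : ℂ) * ((u ^ t.1 : ℂˣ) : ℂ)) * X ^ (t.2 + N).toNat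
  have hev : ∀ k : ℤ, p.eval ((v ^ k : ℂˣ) : ℂ) = (((v ^ k) ^ N : ℂˣ) : ℂ) * ev u (v ^ k) Q := by
    intro k
    rw [ev_eq_sum, Finset.mul_sum, eval_finsetSum]
    refine Finset.sum_congr rfl fun t ht => ?_
    rw [eval_mul, eval_C, eval_pow, eval_X, ← Units.val_pow_eq_pow_val, ← zpow_natCast,
      Int.toNat_of_nonneg (hN t ht), zpow_add, Units.val_mul, Units.val_mul]
    ring
  have hp : p = 0 := by
    refine eq_zero_of_infinite_isRoot p ?_
    refine (hQ.image (f := fun k : ℤ => ((v ^ k : ℂˣ) : ℂ))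
      (fun a _ b _ hab => zpow_injective_of_not_isOfFinOrder hv (Units.ext hab))).mono ?_
    rintro _ ⟨k, hk, rfl⟩
    change p.eval _ = 0
    rw [hev, Set.mem_ofPred.1 hk, mul_zero]
  have hcoef : ∀ l ∈ s.image Prod.snd,
      ∑ t ∈ s with t.2 = l, (Q.coeff t : ℂ) * ((u ^ t.1 : ℂˣ) : ℂ) = 0 := by
    intro l hl
    have h0 : p.coeff (l + N).toNat = 0 := by rw [hp, coeff_zero]
    rw [← h0, Finset.sum_filter, finsetSum_coeff]
    refine Finset.sum_congr rfl fun t ht => ?_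
    obtain ⟨t', ht', rfl⟩ := Finset.mem_image.1 hl
    have h1 := hN t ht
    have h2 := hN t' ht'
    rw [coeff_C_mul, coeff_X_pow, mul_ite, mul_one, mul_zero]
    refine if_congr ?_ rfl rfl
    omega
  rw [eq_sum_single Q, ← Finset.sum_fiberwise_of_maps_to (t := s.image Prod.snd) (g := Prod.snd)
    fun t ht => Finset.mem_image_of_mem _ ht]
  refine Ideal.sum_mem _ fun l hl => ?_
  have h1 := h.sum_single_mem _ (fun t => Q.coeff t) (fun t : ℤ × ℤ => t.1) (hcoef l hl)
  have h2 := Ideal.mul_mem_left _ (AddMonoidAlgebra.single (0, l) 1) h1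
  rw [Finset.mul_sum] at h2
  convert h2 using 1
  refine Finset.sum_congr rfl fun t ht => ?_
  rw [AddMonoidAlgebra.single_mul_single]
  simp [← (Finset.mem_filter.1 ht).2]

/-- If `P` is irreducible with a root `v` that is not a root of unity, then `v ^ i` is a root of
`P` only for `i = ±1`. -/
theorem eq_one_or_eq_neg_one_of_aeval_zpow {P : ℤ[X]} (hP : Irreducible P) {v : ℂˣ}
    (hv : ¬IsOfFinOrder v) (hPv : aeval (v : ℂ) P = 0) {i : ℤ}
    (hi : aeval ((v ^ i : ℂˣ) : ℂ) P = 0) : i = 1 ∨ i = -1 := by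
  have hsum : ∀ u : ℂˣ, aeval ((u ^ i : ℂˣ) : ℂ) P =
      ∑ k ∈ P.support, (P.coeff k : ℂ) * ((u ^ (i * k) : ℂˣ) : ℂ) := by
    intro u
    rw [aeval_eq_sum_range, ← P.sum_over_range' (f := fun k c => c • ((u ^ i : ℂˣ) : ℂ) ^ k)
      (fun n => by simp) _ (Nat.lt_succ_self _), Polynomial.sum]
    refine Finset.sum_congr rfl fun k _ => ?_
    rw [zpow_mul, zpow_natCast, Units.val_pow_eq_pow_val, zsmul_eq_mul]
  -- `P(x^i)` vanishes at `v`, hence is a multiple of `P(x)` among Laurent polynomials; so the roots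
  -- of `P` are stable under `u ↦ u^i`. All the `v^(i^n)` are then roots, and only finitely many can
  -- be distinct.
  have hstep : ∀ u : ℂˣ, aeval (u : ℂ) P = 0 → aeval ((u ^ i : ℂˣ) : ℂ) P = 0 := by
    intro u hu
    have hle : Ideal.span {aeval Lx P} ≤ RingHom.ker (ev u 1).toRingHom := by
      rw [Ideal.span_le, Set.singleton_subset_iff]
      exact (ev_aeval_Lx u 1 P).trans hu
    have h1 := hle ((isMinRoot_of_irreducible hP hPv).sum_single_mem P.support P.coeff
      (fun k => i * k) ((hsum v).symm.trans hi))
    rw [hsum]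
    change ev u 1 _ = 0 at h1
    rw [map_sum] at h1
    simpa only [ev_single, one_zpow, mul_one] using h1
  have hall : ∀ n : ℕ, aeval ((v ^ (i ^ n) : ℂˣ) : ℂ) P = 0 := by
    intro n
    induction n with
    | zero => simpa using hPv
    | succ n ih =>
      rw [pow_succ, zpow_mul]
      exact hstep _ ih
  have hninj : ¬Function.Injective fun n : ℕ => i ^ n := by
    intro hinj
    refine (Set.infinite_range_of_injective (f := fun n : ℕ => ((v ^ (i ^ n) : ℂˣ) : ℂ))
      fun a b hab => hinj (zpow_injective_of_not_isOfFinOrder hv (Units.ext hab))) ?_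
    refine (P.rootSet_finite ℂ).subset ?_
    rintro _ ⟨n, rfl⟩
    exact (mem_rootSet.2 ⟨hP.ne_zero, hall n⟩)
  -- The powers of `0` also repeat, so this value is excluded separately: `1` would be a root, so `P
  -- ∣ X - 1` and `v = 1`.
  have hi0 : i ≠ 0 := by
    rintro rfl
    rw [zpow_zero] at hi
    have h1 := (isMinRoot_of_irreducible hP hi (X - 1)).1 (by simp)
    have h2 := (isMinRoot_of_irreducible hP hPv (X - 1)).2 h1
    refine hv ?_
    have : v = 1 := Units.ext (by simpa [sub_eq_zero] using h2)
    rw [this]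
    exact IsOfFinOrder.one
  by_contra hcon
  refine hninj (fun a b hab => ?_)
  have h2 : 2 ≤ i.natAbs := by omega
  have := congrArg Int.natAbs hab
  simp only [Int.natAbs_pow] at this
  exact Nat.pow_right_injective h2 this

/-- Distinct powers of a transcendental number are linearly independent. -/
theorem IsMinRoot.sum_finsupp_single_eq_zero {v : ℂˣ} (h : IsMinRoot 0 v) {ι : Type*}
    (s : Finset ι) (β f : ι → ℤ) (hs : ∑ t ∈ s, (β t : ℂ) * ((v ^ f t : ℂˣ) : ℂ) = 0) :
    ∑ t ∈ s, Finsupp.single (f t) (β t) = 0 := by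
  have h1 := h.sum_single_mem s β f hs
  rw [map_zero, Ideal.span_singleton_eq_bot.2 rfl, Ideal.mem_bot] at h1
  have h2 := congrArg AddMonoidAlgebra.coeff h1
  rw [AddMonoidAlgebra.coeff_sum] at h2
  refine Finsupp.mapDomain_injective (f := fun k : ℤ => (k, (0 : ℤ)))
    (fun a b hab => congrArg Prod.fst hab) ?_
  rw [Finsupp.mapDomain_finsetSum]
  simpa using h2

theorem IsMinRoot.zpow_of_zero {v : ℂˣ} (h : IsMinRoot 0 v) {g : ℤ} (hg : g ≠ 0) :
    IsMinRoot 0 (v ^ g) := by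
  intro p
  rw [zero_dvd_iff]
  refine ⟨fun hp => ?_, fun hp => by simp [hp]⟩
  have hs : ∑ k ∈ p.support, (p.coeff k : ℂ) * ((v ^ (g * k) : ℂˣ) : ℂ) = 0 := by
    rw [← hp, aeval_eq_sum_range, ← p.sum_over_range' (f := fun k c => c • ((v ^ g : ℂˣ) : ℂ) ^ k)
      (fun n => by simp) _ (Nat.lt_succ_self _), Polynomial.sum]
    refine Finset.sum_congr rfl fun k _ => ?_
    rw [zpow_mul, zpow_natCast, Units.val_pow_eq_pow_val, zsmul_eq_mul]
  have h1 := h.sum_finsupp_single_eq_zero _ _ _ hs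
  ext k
  rw [coeff_zero]
  by_contra hk
  have h2 := DFunLike.congr_fun h1 (g * k)
  rw [Finsupp.finsetSum_apply, Finset.sum_eq_single k] at h2
  · simp at h2
    exact hk h2
  · intro b _ hb
    rw [Finsupp.single_apply, if_neg]
    intro hbk
    exact hb (by exact_mod_cast mul_left_cancel₀ hg hbk)
  · intro hk'
    simp [notMem_support_iff.1 hk']

end KrullML
namespace KrullML

open Polynomial

/-! ### The ideal of `M(λ)` -/

open Classical in
/-- `Φ_m` if `λ` is a primitive `m`-th root of unity, `P_λ` otherwise. -/
noncomputable def lamPoly (lam : ℂˣ) : ℤ[X] :=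
  if IsOfFinOrder lam then cyclotomic (orderOf lam) ℤ else minPolyZ lam

open Classical in
/-- The order of a root of unity, and `1` for other numbers. -/
noncomputable def lamPeriod (lam : ℂˣ) : ℤ :=
  if IsOfFinOrder lam then orderOf lam else 1

theorem lamPeriod_ne_zero (lam : ℂˣ) : lamPeriod lam ≠ 0 := by
  rw [lamPeriod]
  split_ifs with h
  · exact_mod_cast h.orderOf_pos.ne'
  · exact one_ne_zero

theorem isMinRoot_lamPoly (lam : ℂˣ) : IsMinRoot (lamPoly lam) lam := by
  rw [lamPoly]
  split_ifs with h
  · exact isMinRoot_cyclotomic h.orderOf_pos rfl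
  · exact (minPolyZ_spec lam).1

theorem MlamIdeal_of_isOfFinOrder {lam : ℂˣ} (h : IsOfFinOrder lam) :
    MlamIdeal lam = Ideal.span {aeval Lx (lamPoly lam), Ly - 1} := by
  rw [MlamIdeal, lamPoly, if_pos h, if_pos h]

theorem MlamIdeal_of_not_isOfFinOrder {lam : ℂˣ} (h : ¬IsOfFinOrder lam) :
    MlamIdeal lam = Ideal.span {aeval Lx (lamPoly lam)} := by
  rw [MlamIdeal, lamPoly, if_neg h, if_neg h]

theorem aeval_lamPoly_mem (lam : ℂˣ) : aeval Lx (lamPoly lam) ∈ MlamIdeal lam := by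
  by_cases h : IsOfFinOrder lam
  · rw [MlamIdeal_of_isOfFinOrder h]
    exact Ideal.subset_span (by simp)
  · rw [MlamIdeal_of_not_isOfFinOrder h]
    exact Ideal.subset_span (by simp)

theorem zpow_lamPeriod_mul {lam : ℂˣ} (h : IsOfFinOrder lam) (k : ℤ) :
    lam ^ (lamPeriod lam * k) = 1 := by
  rw [lamPeriod, if_pos h, zpow_mul, zpow_natCast, pow_orderOf_eq_one, one_zpow]

/-- These points are the exponents of the homomorphisms `a ↦ a`, `b ↦ b a^(mk)`. For a root of unity
they all coincide with `(λ, 1)`; otherwise the ideal puts no condition on `y`. -/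
theorem ev_eq_zero_of_mem {lam : ℂˣ} {Q : L} (hQ : Q ∈ MlamIdeal lam) (k : ℤ) :
    ev lam (lam ^ (lamPeriod lam * k)) Q = 0 := by
  by_cases h : IsOfFinOrder lam
  · rw [zpow_lamPeriod_mul h, (isMinRoot_lamPoly lam).ev_one_eq_zero_iff]
    rwa [MlamIdeal_of_isOfFinOrder h] at hQ
  · rw [MlamIdeal_of_not_isOfFinOrder h] at hQ
    have : Ideal.span {aeval Lx (lamPoly lam)} ≤
        RingHom.ker (ev lam (lam ^ (lamPeriod lam * k))).toRingHom := by
      rw [Ideal.span_le, Set.singleton_subset_iff]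
      exact (ev_aeval_Lx _ _ _).trans (isMinRoot_lamPoly lam).aeval_eq_zero
    exact this hQ

/-- For a root of unity, `MlamIdeal` is the full ideal of the point `(λ, 1)` and the set is empty.
Otherwise infinitely many zeros would force `Q` into the ideal. -/
theorem finite_setOf_ev_eq_zero {lam : ℂˣ} {Q : L} (hQ : Q ∉ MlamIdeal lam) :
    {k : ℤ | ev lam (lam ^ (lamPeriod lam * k)) Q = 0}.Finite := by
  by_cases h : IsOfFinOrder lam
  · convert Set.finite_empty (α := ℤ)
    ext k
    simp only [Set.mem_ofPred_eq, Set.mem_empty_iff_false, iff_false]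
    rwa [zpow_lamPeriod_mul h, (isMinRoot_lamPoly lam).ev_one_eq_zero_iff,
      ← MlamIdeal_of_isOfFinOrder h]
  · by_contra hinf
    refine hQ ?_
    rw [MlamIdeal_of_not_isOfFinOrder h]
    refine (isMinRoot_lamPoly lam).mem_span_of_infinite h Q ?_
    simpa [lamPeriod, h] using hinf

/-! ### The exponents of the homomorphisms to `G(λ)` -/

/-- The pair `(i, j)` is realised by a homomorphism from `M(λ)` to `G(λ)` with non-abelian image that
maps `a`, `b` to elements over `i`, `j ∈ ℤ`. -/
def IsExponent (lam : ℂˣ) (x : ℤ × ℤ) : Prop :=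
  (∀ Q ∈ MlamIdeal lam, ev (lam ^ x.1) (lam ^ x.2) Q = 0) ∧ (lam ^ x.1 ≠ 1 ∨ lam ^ x.2 ≠ 1)

theorem IsExponent.aeval_eq_zero {lam : ℂˣ} {x : ℤ × ℤ} (h : IsExponent lam x) :
    aeval ((lam ^ x.1 : ℂˣ) : ℂ) (lamPoly lam) = 0 := by
  rw [← ev_aeval_Lx _ (lam ^ x.2)]
  exact h.1 _ (aeval_lamPoly_mem lam)

theorem IsExponent.orderOf_eq {lam : ℂˣ} (hfin : IsOfFinOrder lam) {x : ℤ × ℤ}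
    (h : IsExponent lam x) : orderOf (lam ^ x.1) = orderOf lam := by
  have h1 := h.aeval_eq_zero
  rw [lamPoly, if_pos hfin] at h1
  exact orderOf_of_aeval_cyclotomic hfin.orderOf_pos h1

theorem IsExponent.zpow_snd {lam : ℂˣ} (hfin : IsOfFinOrder lam) {x : ℤ × ℤ}
    (h : IsExponent lam x) : lam ^ x.2 = 1 := by
  have h1 := h.1 (Ly - 1) (by
    rw [MlamIdeal_of_isOfFinOrder hfin]
    exact Ideal.subset_span (by simp))
  rw [map_sub, ev_Ly, map_one, sub_eq_zero] at h1
  exact Units.ext h1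

theorem IsExponent.ne_zero {lam : ℂˣ} {x : ℤ × ℤ} (h : IsExponent lam x) : x ≠ 0 := by
  rintro rfl
  simpa using h.2

theorem irreducible_lamPoly_or {lam : ℂˣ} (hfin : ¬IsOfFinOrder lam) :
    lamPoly lam = 0 ∨ Irreducible (lamPoly lam) := by
  rw [lamPoly, if_neg hfin]
  exact (minPolyZ_spec lam).2

theorem IsMinRoot.ev_one_iff {P : ℤ[X]} {u v : ℂˣ} (hu : IsMinRoot P u) (hv : IsMinRoot P v)
    (Q : L) : ev u 1 Q = 0 ↔ ev v 1 Q = 0 := by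
  rw [hu.ev_one_eq_zero_iff, hv.ev_one_eq_zero_iff]

/-- For a root of unity, the order of `λ^g` lies between those of `λ^i` and `λ`, which agree; a
non-zero power of a transcendental number is transcendental. In the remaining case `i = ±1`, hence
`g = ±1`, and only here can the sign matter. -/
theorem IsExponent.isMinRoot_zpow {lam : ℂˣ} {x : ℤ × ℤ} (h : IsExponent lam x) {g : ℤ}
    (h₁ : g ∣ x.1) (h₂ : g ∣ x.2) :
    IsMinRoot (lamPoly lam) (lam ^ g) ∨ IsMinRoot (lamPoly lam) (lam ^ (-g)) := by
  by_cases hfin : IsOfFinOrder lam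
  · left
    rw [lamPoly, if_pos hfin]
    refine isMinRoot_cyclotomic hfin.orderOf_pos (Nat.dvd_antisymm (orderOf_dvd_of_mem_zpowers ⟨_, rfl⟩) ?_)
    obtain ⟨k, hk⟩ := h₁
    rw [← h.orderOf_eq hfin, hk, zpow_mul]
    exact orderOf_dvd_of_mem_zpowers ⟨_, rfl⟩
  · rcases irreducible_lamPoly_or hfin with h0 | hirr
    · left
      have hmin := isMinRoot_lamPoly lam
      rw [h0] at hmin ⊢
      refine hmin.zpow_of_zero ?_
      rintro rfl
      exact h.ne_zero (Prod.ext (zero_dvd_iff.1 h₁) (zero_dvd_iff.1 h₂))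
    · have hlam := isMinRoot_lamPoly lam
      have hi := eq_one_or_eq_neg_one_of_aeval_zpow hirr hfin hlam.aeval_eq_zero h.aeval_eq_zero
      have hg : g = 1 ∨ g = -1 := by
        rw [← Int.isUnit_iff] at hi ⊢
        exact isUnit_of_dvd_unit h₁ hi
      rcases hg with rfl | rfl
      · left; simpa using hlam
      · right; simpa using hlam

/-- Two exponents of the same type: homomorphisms with these exponents have the same kernel. -/
def SameType (lam : ℂˣ) (x y : ℤ × ℤ) : Prop :=
  (∀ Q, ev (lam ^ x.1) (lam ^ x.2) Q = 0 → ev (lam ^ y.1) (lam ^ y.2) Q = 0) ∧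
    ∀ p q : ℤ, x.1 * p + x.2 * q = 0 → y.1 * p + y.2 * q = 0

/-- Both `x` and `y` lie on the line orthogonal to `d`, and `x ≠ 0`, so `y` is a rational multiple
of `x`. -/
theorem eq_zero_of_orthogonal {x y d : ℤ × ℤ} (hx : x ≠ 0) (hd : d ≠ 0)
    (hxd : x.1 * d.1 + x.2 * d.2 = 0) (hyd : y.1 * d.1 + y.2 * d.2 = 0) {p q : ℤ}
    (h : x.1 * p + x.2 * q = 0) : y.1 * p + y.2 * q = 0 := by
  obtain ⟨i, j⟩ := x
  obtain ⟨a, b⟩ := d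
  simp only [ne_eq, Prod.mk_eq_zero, not_and_or] at *
  have hdet : a * q - b * p = 0 := by
    rcases hx with hi | hj
    · refine (mul_eq_zero.1 (?_ : i * (a * q - b * p) = 0)).resolve_left hi
      linear_combination q * hxd - b * h
    · refine (mul_eq_zero.1 (?_ : j * (a * q - b * p) = 0)).resolve_left hj
      linear_combination a * h - p * hxd
  rcases hd with ha | hb
  · refine (mul_eq_zero.1 (?_ : a * (y.1 * p + y.2 * q) = 0)).resolve_left ha
    linear_combination p * hyd + y.2 * hdet
  · refine (mul_eq_zero.1 (?_ : b * (y.1 * p + y.2 * q) = 0)).resolve_left hb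
    linear_combination q * hyd - y.1 * hdet

/-- For transcendental `λ`, `Q(λ^i, λ^j) = 0` means that the coefficients of `Q` cancel on every
level line of `t ↦ ⟨x, t⟩`. The form `⟨y, ·⟩` is constant on these lines, so the cancellation
persists. -/
theorem sameType_of_isMinRoot_zero {lam : ℂˣ} (hlam : IsMinRoot 0 lam) {x y d : ℤ × ℤ} (hx : x ≠ 0)
    (hd : d ≠ 0) (hxd : x.1 * d.1 + x.2 * d.2 = 0) (hyd : y.1 * d.1 + y.2 * d.2 = 0) :
    SameType lam x y := by
  refine ⟨fun Q hQ => ?_, fun p q => eq_zero_of_orthogonal hx hd hxd hyd⟩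
  have hform : ∀ z : ℤ × ℤ, ev (lam ^ z.1) (lam ^ z.2) Q =
      ∑ t ∈ Q.coeff.support, (Q.coeff t : ℂ) * ((lam ^ (z.1 * t.1 + z.2 * t.2) : ℂˣ) : ℂ) := by
    intro z
    rw [ev_eq_sum]
    simp only [zpow_add, zpow_mul]
  rw [hform] at hQ ⊢
  have hfac : Function.FactorsThrough (fun t : ℤ × ℤ => y.1 * t.1 + y.2 * t.2)
      fun t : ℤ × ℤ => x.1 * t.1 + x.2 * t.2 := by
    intro s t hst
    have := eq_zero_of_orthogonal (p := s.1 - t.1) (q := s.2 - t.2) hx hd hxd hyd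
      (by linear_combination hst)
    linear_combination this
  let e := Function.extend (fun t : ℤ × ℤ => x.1 * t.1 + x.2 * t.2)
    (fun t : ℤ × ℤ => y.1 * t.1 + y.2 * t.2) 0
  have he : ∀ t : ℤ × ℤ, e (x.1 * t.1 + x.2 * t.2) = y.1 * t.1 + y.2 * t.2 := fun t =>
    hfac.extend_apply _ t
  have h1 := hlam.sum_finsupp_single_eq_zero _ _ _ hQ
  have h2 := congrArg (Finsupp.liftAddHom fun k : ℤ =>
    (AddMonoidHom.mulRight ((lam ^ e k : ℂˣ) : ℂ)).comp (Int.castAddHom ℂ)) h1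
  rw [map_sum, map_zero] at h2
  rw [← h2]
  refine Finset.sum_congr rfl fun t _ => ?_
  rw [Finsupp.liftAddHom_apply_single, he]
  simp

/-- A coefficient of `Q` can cancel only against another one on the same level line of `⟨x, ·⟩`. -/
theorem exists_orthogonal_of_ev_eq_zero {lam : ℂˣ} (hlam : IsMinRoot 0 lam) {Q : L} (hQ : Q ≠ 0)
    {x : ℤ × ℤ} (hx : ev (lam ^ x.1) (lam ^ x.2) Q = 0) :
    ∃ s ∈ Q.coeff.support, ∃ t ∈ Q.coeff.support, s ≠ t ∧
      x.1 * (s - t).1 + x.2 * (s - t).2 = 0 := by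
  have hsum : ∑ t ∈ Q.coeff.support,
      (Q.coeff t : ℂ) * ((lam ^ (x.1 * t.1 + x.2 * t.2) : ℂˣ) : ℂ) = 0 := by
    rw [← hx, ev_eq_sum]
    simp only [zpow_add, zpow_mul]
  have h1 := hlam.sum_finsupp_single_eq_zero _ _ _ hsum
  obtain ⟨s, hs⟩ : Q.coeff.support.Nonempty := by
    rw [Finsupp.support_nonempty_iff]
    exact fun h => hQ (AddMonoidAlgebra.coeff_eq_zero.1 h)
  refine ⟨s, hs, ?_⟩
  by_contra! hcon
  have h2 := DFunLike.congr_fun h1 (x.1 * s.1 + x.2 * s.2)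
  rw [Finsupp.finsetSum_apply, Finset.sum_eq_single_of_mem s hs] at h2
  · rw [Finsupp.single_eq_same] at h2
    exact Finsupp.mem_support_iff.1 hs h2
  · intro t ht hts
    rw [Finsupp.single_apply, if_neg]
    intro heq
    refine hcon t ht hts.symm ?_
    rw [Prod.fst_sub, Prod.snd_sub]
    linear_combination -heq

/-- The exponents of the homomorphisms that kill a given non-trivial element
`a ^ p * b ^ q * c ^ Q` are of finitely many types. -/
theorem exists_finite_types (lam : ℂˣ) {p q : ℤ} {Q : L}
    (hne : p = 0 → q = 0 → Q ∉ MlamIdeal lam) :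
    ∃ (D : Finset (ℤ × ℤ)) (κ : ℤ × ℤ → ℤ × ℤ → Prop),
      ∀ x, IsExponent lam x → x.1 * p + x.2 * q = 0 →
        (p = 0 → q = 0 → ev (lam ^ x.1) (lam ^ x.2) Q = 0) →
        (∃ d ∈ D, κ x d) ∧ ∀ y, IsExponent lam y → y.1 * p + y.2 * q = 0 →
          (p = 0 → q = 0 → ev (lam ^ y.1) (lam ^ y.2) Q = 0) →
          ∀ d ∈ D, κ x d → κ y d → SameType lam x y := by
  classical
  have hmin := isMinRoot_lamPoly lam
  by_cases hfin : IsOfFinOrder lam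
  · refine ⟨{0}, fun _ _ => True, fun x hx hxl hxQ => ⟨⟨0, by simp⟩, ?_⟩⟩
    have hker : ∀ z, IsExponent lam z → ∀ Q,
        ev (lam ^ z.1) (lam ^ z.2) Q = 0 ↔ Q ∈ MlamIdeal lam := by
      intro z hz Q
      rw [hz.zpow_snd hfin, MlamIdeal_of_isOfFinOrder hfin]
      refine IsMinRoot.ev_one_eq_zero_iff ?_ Q
      rw [lamPoly, if_pos hfin]
      exact isMinRoot_cyclotomic hfin.orderOf_pos (hz.orderOf_eq hfin)
    intro y hy hyl _ _ _ _ _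
    refine ⟨fun Q' => ((hker x hx Q').trans (hker y hy Q').symm).1, fun p' q' =>
      eq_zero_of_orthogonal (d := (p, q)) hx.ne_zero ?_ hxl hyl⟩
    intro h0
    obtain ⟨hp, hq⟩ := Prod.mk_eq_zero.1 h0
    exact hne hp hq ((hker x hx Q).1 (hxQ hp hq))
  -- Both kinds of conditions become the vanishing of one Laurent polynomial: `Q` itself, or `x^p
  -- y^q - 1` if `(p, q) ≠ 0`.
  obtain ⟨R, hR, hRz⟩ : ∃ R : L, R ∉ MlamIdeal lam ∧ ∀ x : ℤ × ℤ, x.1 * p + x.2 * q = 0 →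
      (p = 0 → q = 0 → ev (lam ^ x.1) (lam ^ x.2) Q = 0) →
      ev (lam ^ x.1) (lam ^ x.2) R = 0 := by
    by_cases h0 : p = 0 ∧ q = 0
    · exact ⟨Q, hne h0.1 h0.2, fun x _ h => h h0.1 h0.2⟩
    · have hev : ∀ u v : ℂˣ, ev u v (AddMonoidAlgebra.single (p, q) 1 - 1) =
          ((u ^ p * v ^ q : ℂˣ) : ℂ) - 1 := by
        intro u v
        rw [map_sub, map_one, ev_single, Int.cast_one, one_mul]
      refine ⟨AddMonoidAlgebra.single (p, q) 1 - 1, fun hmem => h0 ?_, fun x hx _ => ?_⟩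
      · have hk : ∀ k : ℤ, p + k * q = 0 := by
          intro k
          have h1 := ev_eq_zero_of_mem hmem k
          rw [hev, sub_eq_zero, lamPeriod, if_neg hfin, one_mul, ← zpow_mul, ← zpow_add] at h1
          refine zpow_injective_of_not_isOfFinOrder hfin (Units.ext ?_)
          simpa using h1
        have h1 := hk 0
        have h2 := hk 1
        constructor <;> linarith
      · rw [hev, ← zpow_mul, ← zpow_mul, ← zpow_add, hx, zpow_zero, Units.val_one, sub_self]
  rcases irreducible_lamPoly_or hfin with h0 | hirr
  · rw [h0] at hmin
    have hR0 : R ≠ 0 := fun h => hR (h ▸ Ideal.zero_mem _)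
    -- Transcendental case: a type is a line through the origin, labelled by an orthogonal
    -- difference of two points of the support of `R`.
    let D := ((R.coeff.support ×ˢ R.coeff.support).image fun st => st.1 - st.2).filter (· ≠ 0)
    refine ⟨D, fun x d => x.1 * d.1 + x.2 * d.2 = 0, fun x hx hxl hxQ => ⟨?_, ?_⟩⟩
    · obtain ⟨s, hs, t, ht, hst, hxst⟩ := exists_orthogonal_of_ev_eq_zero hmin hR0 (hRz x hxl hxQ)
      exact ⟨s - t, Finset.mem_filter.2 ⟨Finset.mem_image.2
        ⟨(s, t), Finset.mem_product.2 ⟨hs, ht⟩, rfl⟩, sub_ne_zero.2 hst⟩, hxst⟩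
    · intro y _ _ _ d hd hxd hyd
      exact sameType_of_isMinRoot_zero hmin hx.ne_zero (Finset.mem_filter.1 hd).2 hxd hyd
  -- Algebraic case: `i = ±1`, and for each `i` only finitely many `j` make `R` vanish, so every
  -- exponent can be a type by itself.
  · let X : Set (ℤ × ℤ) := {x | IsExponent lam x ∧ ev (lam ^ x.1) (lam ^ x.2) R = 0}
    have hfinite : ∀ i : ℤ, {x : ℤ × ℤ | x ∈ X ∧ x.1 = i}.Finite := by
      intro i
      by_cases hi : aeval ((lam ^ i : ℂˣ) : ℂ) (lamPoly lam) = 0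
      · have h1 : {k : ℤ | ev (lam ^ i) (lam ^ k) R = 0}.Finite := by
          by_contra hinf
          refine hR ?_
          rw [MlamIdeal_of_not_isOfFinOrder hfin]
          exact (isMinRoot_of_irreducible hirr hi).mem_span_of_infinite hfin R hinf
        refine (h1.image fun k => (i, k)).subset ?_
        rintro ⟨_, j⟩ ⟨hx, rfl⟩
        exact ⟨j, hx.2, rfl⟩
      · convert Set.finite_empty (α := ℤ × ℤ)
        ext x
        simp only [Set.mem_ofPred_eq, Set.mem_empty_iff_false, iff_false]
        rintro ⟨hx, rfl⟩
        exact hi hx.1.aeval_eq_zero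
    have hX : X.Finite := by
      refine ((hfinite 1).union (hfinite (-1))).subset fun x hx => ?_
      rcases eq_one_or_eq_neg_one_of_aeval_zpow hirr hfin hmin.aeval_eq_zero
        hx.1.aeval_eq_zero with h | h
      · exact Or.inl ⟨hx, h⟩
      · exact Or.inr ⟨hx, h⟩
    refine ⟨hX.toFinset, Eq, fun x hx hxl hxQ => ⟨⟨x, ?_, rfl⟩, ?_⟩⟩
    · exact hX.mem_toFinset.2 ⟨hx, hRz x hxl hxQ⟩
    · rintro y _ _ _ d _ rfl rfl
      exact ⟨fun _ h => h, fun _ _ h => h⟩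

end KrullML
namespace KrullML

open scoped commutatorElement

/-! ### Metabelian images of `F` -/

section Metabelian

variable {H : Type*} [Group H] {f : F →* H}

theorem commute_of_mem_derivedSeries_one (hf : derivedSeries F 2 ≤ f.ker) {x y : F}
    (hx : x ∈ derivedSeries F 1) (hy : y ∈ derivedSeries F 1) : Commute (f x) (f y) := by
  have h : ⁅x, y⁆ ∈ f.ker := hf (Subgroup.commutator_mem_commutator hx hy)
  rw [MonoidHom.mem_ker, map_commutatorElement, commutatorElement_eq_one_iff_commute] at h
  exact h

theorem commutator_mem_derivedSeries_one (x y : F) : x * y * x⁻¹ * y⁻¹ ∈ derivedSeries F 1 :=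
  Subgroup.commutator_mem_commutator (Subgroup.mem_top x) (Subgroup.mem_top y)

theorem conj_commutator_zpow_mem (x : F) (n : ℤ) :
    x * (fa * fb * fa⁻¹ * fb⁻¹) ^ n * x⁻¹ ∈ derivedSeries F 1 :=
  (derivedSeries_normal F 1).conj_mem _
    (Subgroup.zpow_mem _ (commutator_mem_derivedSeries_one fa fb) n) x

theorem commPow_single (i j n : ℤ) : commPow (AddMonoidAlgebra.single (i, j) n) =
    fa ^ i * fb ^ j * (fa * fb * fa⁻¹ * fb⁻¹) ^ n * (fa ^ i * fb ^ j)⁻¹ := by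
  by_cases hn : n = 0
  · simp [commPow, hn]
  · rw [commPow, AddMonoidAlgebra.coeff_single, Finsupp.support_single _ hn]
    simp

/-- `Q ↦ c^Q` is a homomorphism modulo `F''`. -/
theorem exists_monoidHom_commPow (hf : derivedSeries F 2 ≤ f.ker) :
    ∃ Φ : Multiplicative L →* H, ∀ Q, f (commPow Q) = Φ (Multiplicative.ofAdd Q) := by
  let e : ℤ × ℤ → H := fun p =>
    f (fa ^ p.1 * fb ^ p.2 * (fa * fb * fa⁻¹ * fb⁻¹) * (fa ^ p.1 * fb ^ p.2)⁻¹)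
  have he : ∀ p, ∀ n : ℤ, f (fa ^ p.1 * fb ^ p.2 * (fa * fb * fa⁻¹ * fb⁻¹) ^ n *
      (fa ^ p.1 * fb ^ p.2)⁻¹) = e p ^ n := by
    intro p n
    rw [← map_zpow, conj_zpow]
  have hcomm : ∀ x ∈ Set.range e, ∀ y ∈ Set.range e, x * y = y * x := by
    rintro _ ⟨p, rfl⟩ _ ⟨q, rfl⟩
    refine commute_of_mem_derivedSeries_one hf ?_ ?_
    · simpa using conj_commutator_zpow_mem (fa ^ p.1 * fb ^ p.2) 1
    · simpa using conj_commutator_zpow_mem (fa ^ q.1 * fb ^ q.2) 1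
  -- The conjugates of `c` commute in the image, so the ordered product defining `commPow` may be
  -- computed in a commutative group.
  have hK := Subgroup.isMulCommutative_closure hcomm
  let _ : CommGroup (Subgroup.closure (Set.range e)) :=
    { (inferInstance : Group (Subgroup.closure (Set.range e))) with mul_comm := mul_comm' }
  let E : ℤ × ℤ → Subgroup.closure (Set.range e) := fun p =>
    ⟨e p, Subgroup.subset_closure ⟨p, rfl⟩⟩
  let Ψ : Multiplicative L →* Subgroup.closure (Set.range e) :=
    { toFun := fun Q => Q.toAdd.coeff.prod fun p n => E p ^ n
      map_one' := Finsupp.prod_zero_index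
      map_mul' := fun Q R => Finsupp.prod_add_index' (fun p => zpow_zero _) fun p =>
        zpow_add _ }
  refine ⟨(Subgroup.closure (Set.range e)).subtype.comp Ψ, fun Q => ?_⟩
  have h1 : Ψ (Multiplicative.ofAdd Q) =
      (((Q.coeff.support.map toLex.toEmbedding).sort (· ≤ ·)).map fun p : ℤ ×ₗ ℤ =>
        E (ofLex p) ^ Q.coeff (ofLex p)).prod := by
    rw [← Multiset.prod_coe, ← Multiset.map_coe, Finset.sort_eq]
    change _ = ∏ p ∈ Q.coeff.support.map toLex.toEmbedding, E (ofLex p) ^ Q.coeff (ofLex p)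
    rw [Finset.prod_map]
    rfl
  rw [MonoidHom.comp_apply, h1, map_list_prod, commPow, map_list_prod, List.map_map, List.map_map]
  congr 1
  refine List.map_congr_left fun p _ => ?_
  exact he (ofLex p) _

theorem map_commPow_add (hf : derivedSeries F 2 ≤ f.ker) (Q R : L) :
    f (commPow (Q + R)) = f (commPow Q) * f (commPow R) := by
  obtain ⟨Φ, hΦ⟩ := exists_monoidHom_commPow hf
  rw [hΦ, hΦ, hΦ, ofAdd_add, map_mul]

theorem map_commPow_zero : f (commPow 0) = 1 := by
  simp [commPow]

theorem map_conj_fa_commPow (hf : derivedSeries F 2 ≤ f.ker) (Q : L) :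
    f (fa * commPow Q * fa⁻¹) = f (commPow (Lx * Q)) := by
  induction Q using AddMonoidAlgebra.induction_linear with
  | zero => simp [commPow]
  | add Q R hQ hR =>
    rw [mul_add, map_commPow_add hf, ← hQ, ← hR, map_mul, map_mul, map_commPow_add hf]
    simp only [map_mul, map_inv]
    group
  | single p n =>
    obtain ⟨i, j⟩ := p
    rw [Lx, AddMonoidAlgebra.single_mul_single, Prod.mk_add_mk, commPow_single, commPow_single]
    congr 1
    rw [zpow_add, one_mul]
    group

/-- Unlike for `a`, the prefix `b a^i b^j` has to be reordered. It differs from `a^i b^(1+j)` by a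
commutator, which acts trivially on the image of `F'`. -/
theorem map_conj_fb_commPow (hf : derivedSeries F 2 ≤ f.ker) (Q : L) :
    f (fb * commPow Q * fb⁻¹) = f (commPow (Ly * Q)) := by
  induction Q using AddMonoidAlgebra.induction_linear with
  | zero => simp [commPow]
  | add Q R hQ hR =>
    rw [mul_add, map_commPow_add hf, ← hQ, ← hR, map_mul, map_mul, map_commPow_add hf]
    simp only [map_mul, map_inv]
    group
  | single p n =>
    obtain ⟨i, j⟩ := p
    rw [Ly, AddMonoidAlgebra.single_mul_single, Prod.mk_add_mk, commPow_single, commPow_single]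
    have h := commute_of_mem_derivedSeries_one hf
      (commutator_mem_derivedSeries_one fb (fa ^ i)) (conj_commutator_zpow_mem
        (fa ^ i * fb ^ (1 + j)) n)
    have key : fb * (fa ^ i * fb ^ j * (fa * fb * fa⁻¹ * fb⁻¹) ^ n * (fa ^ i * fb ^ j)⁻¹) * fb⁻¹ =
        (fb * fa ^ i * fb⁻¹ * (fa ^ i)⁻¹) * (fa ^ i * fb ^ (1 + j) *
          (fa * fb * fa⁻¹ * fb⁻¹) ^ n * (fa ^ i * fb ^ (1 + j))⁻¹) *
          (fb * fa ^ i * fb⁻¹ * (fa ^ i)⁻¹)⁻¹ := by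
      generalize (fa * fb * fa⁻¹ * fb⁻¹) ^ n = z
      rw [zpow_add]
      group
    rw [key, map_mul, map_mul, h.eq, map_inv, mul_inv_cancel_right, zero_add, one_mul]

/-- Modulo `F''`, every element of `F'` is of the form `c^Q`. -/
theorem exists_map_eq_commPow (hf : derivedSeries F 2 ≤ f.ker) {w : F}
    (hw : w ∈ derivedSeries F 1) : ∃ Q, f w = f (commPow Q) := by
  obtain ⟨Φ, hΦ⟩ := exists_monoidHom_commPow hf
  -- `K` is normal because conjugation by the generators multiplies `Q` by units of `L`. It contains
  -- `c`, so `F / K` is abelian and `F' ≤ K`.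
  let K : Subgroup F := Φ.range.comap f
  have hK : ∀ x, x ∈ K ↔ ∃ Q, f x = f (commPow Q) := by
    intro x
    constructor
    · rintro ⟨Q, hQ⟩
      exact ⟨Q.toAdd, by rw [hΦ]; exact hQ.symm⟩
    · rintro ⟨Q, hQ⟩
      exact ⟨Multiplicative.ofAdd Q, by rw [hQ, hΦ]⟩
  have hx1 : (AddMonoidAlgebra.single (-1, 0) 1 : L) * Lx = 1 := by
    rw [Lx, AddMonoidAlgebra.single_mul_single]; rfl
  have hy1 : (AddMonoidAlgebra.single (0, -1) 1 : L) * Ly = 1 := by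
    rw [Ly, AddMonoidAlgebra.single_mul_single]; rfl
  have hconj : ∀ g x : F, x ∈ K → g * x * g⁻¹ ∈ K ∧ g⁻¹ * x * g ∈ K := by
    intro g
    induction g using FreeGroup.induction_on with
    | C1 => intro x hx; simpa using hx
    | of i =>
      intro x hx
      obtain ⟨Q, hQ⟩ := (hK x).1 hx
      rw [hK, hK]
      have hi : i = 0 ∨ i = 1 := by omega
      rcases hi with rfl | rfl
      · change (∃ R, f (fa * x * fa⁻¹) = _) ∧ ∃ R, f (fa⁻¹ * x * fa) = _
        refine ⟨⟨Lx * Q, ?_⟩, ⟨AddMonoidAlgebra.single (-1, 0) 1 * Q, ?_⟩⟩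
        · rw [← map_conj_fa_commPow hf]
          simp only [map_mul, hQ]
        · have h := map_conj_fa_commPow hf (AddMonoidAlgebra.single (-1, 0) 1 * Q)
          rw [← mul_assoc, mul_comm Lx, hx1, one_mul] at h
          simp only [map_mul, hQ, ← h, map_inv]
          group
      · change (∃ R, f (fb * x * fb⁻¹) = _) ∧ ∃ R, f (fb⁻¹ * x * fb) = _
        refine ⟨⟨Ly * Q, ?_⟩, ⟨AddMonoidAlgebra.single (0, -1) 1 * Q, ?_⟩⟩
        · rw [← map_conj_fb_commPow hf]
          simp only [map_mul, hQ]
        · have h := map_conj_fb_commPow hf (AddMonoidAlgebra.single (0, -1) 1 * Q)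
          rw [← mul_assoc, mul_comm Ly, hy1, one_mul] at h
          simp only [map_mul, hQ, ← h, map_inv]
          group
    | inv_of i ih =>
      intro x hx
      rw [inv_inv]
      exact (ih x hx).symm
    | mul g h ihg ihh =>
      intro x hx
      constructor
      · convert (ihg _ (ihh x hx).1).1 using 1
        group
      · convert (ihh _ (ihg x hx).2).2 using 1
        group
  have hnormal : K.Normal := ⟨fun x hx g => (hconj g x hx).1⟩
  have hc : fa * fb * fa⁻¹ * fb⁻¹ ∈ K := by
    rw [hK]
    refine ⟨AddMonoidAlgebra.single (0, 0) 1, ?_⟩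
    rw [commPow_single]
    simp
  let π := QuotientGroup.mk' K
  have hab : Commute (π fa) (π fb) := by
    have := (QuotientGroup.eq_one_iff (N := K) _).2 hc
    change π _ = 1 at this
    simp only [map_mul, map_inv] at this
    exact commutatorElement_eq_one_iff_commute.1 this
  have hgen : ∀ (i : Fin 2) (y : F), Commute (π (FreeGroup.of i)) (π y) := by
    intro i y
    induction y using FreeGroup.induction_on with
    | C1 => rw [map_one]; exact Commute.one_right _
    | of j =>
      have hi : i = 0 ∨ i = 1 := by omega
      have hj : j = 0 ∨ j = 1 := by omega
      rcases hi with rfl | rfl <;> rcases hj with rfl | rfl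
      · exact Commute.refl _
      · exact hab
      · exact hab.symm
      · exact Commute.refl _
    | inv_of j ih => rw [map_inv]; exact ih.inv_right
    | mul x y hx hy => rw [map_mul]; exact hx.mul_right hy
  have hall : ∀ x y : F, Commute (π x) (π y) := by
    intro x y
    induction x using FreeGroup.induction_on with
    | C1 => rw [map_one]; exact Commute.one_left _
    | of j => exact hgen j y
    | inv_of j ih => rw [map_inv]; exact ih.inv_left
    | mul x z hx hz => rw [map_mul]; exact hx.mul_left hz
  have hle : derivedSeries F 1 ≤ K := by
    rw [derivedSeries_succ, Subgroup.commutator_le]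
    intro x _ y _
    refine (QuotientGroup.eq_one_iff _).1 ?_
    change π _ = 1
    rw [map_commutatorElement]
    exact commutatorElement_eq_one_iff_commute.2 (hall x y)
  exact (hK w).1 (hle hw)

theorem exists_zpow_mul_mem_derivedSeries_one (w : F) :
    ∃ p q : ℤ, (fa ^ p * fb ^ q)⁻¹ * w ∈ derivedSeries F 1 := by
  have h1 : ∀ w : F, ∃ p q : ℤ, Abelianization.of w =
      Abelianization.of fa ^ p * Abelianization.of fb ^ q := by
    intro w
    induction w using FreeGroup.induction_on with
    | C1 => exact ⟨0, 0, by simp⟩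
    | of i =>
      have hi : i = 0 ∨ i = 1 := by omega
      rcases hi with rfl | rfl
      · exact ⟨1, 0, by simp [fa]⟩
      · exact ⟨0, 1, by simp [fb]⟩
    | inv_of i ih =>
      obtain ⟨p, q, h⟩ := ih
      exact ⟨-p, -q, by rw [map_inv, h, mul_inv, zpow_neg, zpow_neg]⟩
    | mul x y hx hy =>
      obtain ⟨p, q, h⟩ := hx
      obtain ⟨p', q', h'⟩ := hy
      exact ⟨p + p', q + q', by rw [map_mul, h, h', zpow_add, zpow_add, mul_mul_mul_comm]⟩
  obtain ⟨p, q, h⟩ := h1 w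
  refine ⟨p, q, ?_⟩
  rw [derivedSeries_one, ← Abelianization.ker_of, MonoidHom.mem_ker, map_mul, map_inv, h, map_mul,
    map_zpow, map_zpow, inv_mul_cancel]

/-- Normal form of the elements of `F` modulo `F''`. -/
theorem exists_map_eq_zpow_mul_commPow (hf : derivedSeries F 2 ≤ f.ker) (w : F) :
    ∃ (p q : ℤ) (Q : L), f w = f (fa ^ p * fb ^ q * commPow Q) := by
  obtain ⟨p, q, h⟩ := exists_zpow_mul_mem_derivedSeries_one w
  obtain ⟨Q, hQ⟩ := exists_map_eq_commPow hf h
  refine ⟨p, q, Q, ?_⟩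
  rw [map_mul, ← hQ, ← map_mul, mul_inv_cancel_left]

end Metabelian

end KrullML
namespace KrullML

open scoped commutatorElement

/-! ### The group `G(λ)` -/

section Glam

variable {lam : ℂˣ}

/-- The component of an element of `G(λ)` in `ℤ[λ^{±1}] ⊆ ℂ`. -/
def lin (g : Glam lam) : ℂ := (g.left.toAdd : Rlam lam)

/-- The component of an element of `G(λ)` in `ℤ`. -/
def ex (g : Glam lam) : ℤ := g.right.toAdd

theorem Glam_ext {g h : Glam lam} (h₁ : lin g = lin h) (h₂ : ex g = ex h) : g = h :=
  SemidirectProduct.ext (Multiplicative.toAdd.injective (Subtype.ext h₁))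
    (Multiplicative.toAdd.injective h₂)

theorem coe_unit_zpow (n : ℤ) :
    (((Rlam.unit lam ^ n : (Rlam lam)ˣ) : Rlam lam) : ℂ) = ((lam ^ n : ℂˣ) : ℂ) := by
  have h : Units.map ((Algebra.adjoin ℤ ({(lam : ℂ), ((lam⁻¹ : ℂˣ) : ℂ)} : Set ℂ)).val :
      Rlam lam →* ℂ) (Rlam.unit lam) = lam := Units.ext rfl
  have h2 := congrArg (fun u : ℂˣ => ((u ^ n : ℂˣ) : ℂ)) h
  simp only [← map_zpow] at h2
  exact h2

theorem lin_mul (g h : Glam lam) : lin (g * h) = lin g + ((lam ^ ex g : ℂˣ) : ℂ) * lin h := by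
  rw [← coe_unit_zpow]
  rfl

theorem ex_mul (g h : Glam lam) : ex (g * h) = ex g + ex h := rfl

theorem lin_one : lin (1 : Glam lam) = 0 := rfl

theorem ex_one : ex (1 : Glam lam) = 0 := rfl

theorem ex_inv (g : Glam lam) : ex g⁻¹ = -ex g := rfl

theorem lin_inv (g : Glam lam) : lin g⁻¹ = -(((lam ^ (-ex g) : ℂˣ) : ℂ) * lin g) := by
  have h := lin_mul g⁻¹ g
  rw [inv_mul_cancel, lin_one, ex_inv] at h
  linear_combination -h

theorem ex_zpow (g : Glam lam) (n : ℤ) : ex (g ^ n) = n * ex g := by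
  have := map_zpow (SemidirectProduct.rightHom (φ := lamAction lam)) g n
  have h2 := congrArg Multiplicative.toAdd this
  simpa [ex] using h2

theorem eq_one_iff_lin_ex (g : Glam lam) : g = 1 ↔ lin g = 0 ∧ ex g = 0 :=
  ⟨fun h => by rw [h]; exact ⟨rfl, rfl⟩, fun h => Glam_ext h.1 h.2⟩

theorem lin_a : lin (Glam.a lam) = 0 := rfl
theorem ex_a : ex (Glam.a lam) = 1 := rfl
theorem lin_b : lin (Glam.b lam) = 1 := rfl
theorem ex_b : ex (Glam.b lam) = 0 := rfl

theorem val_zpow_mul_val_zpow_neg (n : ℤ) :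
    ((lam ^ n : ℂˣ) : ℂ) * ((lam ^ (-n) : ℂˣ) : ℂ) = 1 := by
  rw [← Units.val_mul, ← zpow_add, add_neg_cancel, zpow_zero, Units.val_one]

theorem lin_commutator (g h : Glam lam) : lin (g * h * g⁻¹ * h⁻¹) =
    (1 - ((lam ^ ex h : ℂˣ) : ℂ)) * lin g + (((lam ^ ex g : ℂˣ) : ℂ) - 1) * lin h := by
  simp only [lin_mul, lin_inv, ex_mul, ex_inv, zpow_add, Units.val_mul]
  have h1 := val_zpow_mul_val_zpow_neg (lam := lam) (ex g)
  have h2 := val_zpow_mul_val_zpow_neg (lam := lam) (ex h)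
  linear_combination (-((lam ^ ex h : ℂˣ) : ℂ) * lin g
    - ((lam ^ ex h : ℂˣ) : ℂ) * ((lam ^ (-ex h) : ℂˣ) : ℂ) * lin h) * h1 - lin h * h2

theorem ex_commutator (g h : Glam lam) : ex (g * h * g⁻¹ * h⁻¹) = 0 := by
  simp only [ex_mul, ex_inv]; ring

theorem lin_conj (g : Glam lam) {h : Glam lam} (hh : ex h = 0) :
    lin (g * h * g⁻¹) = ((lam ^ ex g : ℂˣ) : ℂ) * lin h := by
  simp only [lin_mul, lin_inv, ex_mul, hh, add_zero]
  have h1 := val_zpow_mul_val_zpow_neg (lam := lam) (ex g)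
  linear_combination -lin g * h1

theorem lin_zpow {h : Glam lam} (hh : ex h = 0) (n : ℤ) : lin (h ^ n) = n * lin h := by
  have hadd : ∀ k : ℤ, lin (h ^ (k + 1)) = lin (h ^ k) + lin h := by
    intro k
    rw [zpow_add_one, lin_mul, ex_zpow, hh, mul_zero, zpow_zero, Units.val_one, one_mul]
  induction n using Int.induction_on with
  | zero => simp [lin_one]
  | succ n ih => rw [hadd, ih]; push_cast; ring
  | pred n ih =>
    have := hadd (-(n : ℤ) - 1)
    rw [sub_add_cancel, ih] at this
    push_cast at this ⊢
    linear_combination -this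

theorem commute_of_ex_eq_zero {g h : Glam lam} (hg : ex g = 0) (hh : ex h = 0) : Commute g h := by
  refine Glam_ext ?_ ?_
  · rw [lin_mul, lin_mul, hg, hh, zpow_zero, Units.val_one]; ring
  · rw [ex_mul, ex_mul, add_comm]

theorem ex_eq_zero_of_mem_derivedSeries_one (f : F →* Glam lam) {w : F}
    (hw : w ∈ derivedSeries F 1) : ex (f w) = 0 := by
  rw [derivedSeries_one] at hw
  exact congrArg Multiplicative.toAdd
    (Abelianization.commutator_subset_ker
      ((SemidirectProduct.rightHom (φ := lamAction lam)).comp f) hw)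

theorem derivedSeries_two_le_ker (f : F →* Glam lam) : derivedSeries F 2 ≤ f.ker := by
  rw [derivedSeries_succ, Subgroup.commutator_le]
  intro x hx y hy
  rw [MonoidHom.mem_ker, map_commutatorElement, commutatorElement_eq_one_iff_commute]
  exact commute_of_ex_eq_zero (ex_eq_zero_of_mem_derivedSeries_one f hx)
    (ex_eq_zero_of_mem_derivedSeries_one f hy)

theorem ex_map_commPow (f : F →* Glam lam) (Q : L) : ex (f (commPow Q)) = 0 := by
  induction Q using AddMonoidAlgebra.induction_linear with
  | zero => rw [map_commPow_zero, ex_one]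
  | add Q R hQ hR => rw [map_commPow_add (derivedSeries_two_le_ker f), ex_mul, hQ, hR, add_zero]
  | single p n =>
    rw [commPow_single p.1 p.2]
    exact ex_eq_zero_of_mem_derivedSeries_one f (conj_commutator_zpow_mem _ _)

/-- Conjugation by `a^i b^j` multiplies elements over `0` by the corresponding monomial in `λ^(ex (f
fa))` and `λ^(ex (f fb))`. This is the link between relations in groups and zeros of Laurent
polynomials. -/
theorem lin_map_commPow (f : F →* Glam lam) (Q : L) :
    lin (f (commPow Q)) = ev (lam ^ ex (f fa)) (lam ^ ex (f fb)) Q *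
      lin (f (fa * fb * fa⁻¹ * fb⁻¹)) := by
  induction Q using AddMonoidAlgebra.induction_linear with
  | zero => rw [map_commPow_zero, lin_one, map_zero, zero_mul]
  | add Q R hQ hR =>
    rw [map_commPow_add (derivedSeries_two_le_ker f), lin_mul, ex_map_commPow, hQ, hR, map_add,
      zpow_zero, Units.val_one]
    ring
  | single p n =>
    have hc : ex (f (fa * fb * fa⁻¹ * fb⁻¹)) = 0 :=
      ex_eq_zero_of_mem_derivedSeries_one f (commutator_mem_derivedSeries_one _ _)
    rw [commPow_single p.1 p.2, map_mul, map_mul, map_inv, lin_conj, map_zpow, lin_zpow hc,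
      ev_single _ _ p.1 p.2, map_mul, ex_mul, map_zpow, map_zpow, ex_zpow, ex_zpow, ← zpow_mul,
      ← zpow_mul, ← zpow_add, mul_comm (ex (f fa)), mul_comm (ex (f fb))]
    · ring
    · rw [map_zpow, ex_zpow, hc, mul_zero]

/-- The homomorphism from `F` with given values on the generators. -/
def homF {H : Type*} [Group H] (g h : H) : F →* H := FreeGroup.lift ![g, h]

theorem homF_fa {H : Type*} [Group H] (g h : H) : homF g h fa = g := by simp [homF, fa]
theorem homF_fb {H : Type*} [Group H] (g h : H) : homF g h fb = h := by simp [homF, fb]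

theorem homF_ext {H : Type*} [Group H] {f f' : F →* H} (ha : f fa = f' fa) (hb : f fb = f' fb) :
    f = f' := by
  ext i
  have hi : i = 0 ∨ i = 1 := by omega
  rcases hi with rfl | rfl
  · exact ha
  · exact hb

theorem homF_range {H : Type*} [Group H] (g h : H) :
    (homF g h).range = Subgroup.closure {g, h} := by
  rw [homF, FreeGroup.range_lift_eq_closure, Matrix.range_cons, Matrix.range_cons,
    Matrix.range_empty, Set.union_empty, Set.singleton_union]

theorem homF_surjective {H : Type*} [Group H] {g h : H} (hgh : Subgroup.closure {g, h} = ⊤) :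
    Function.Surjective (homF g h) := by
  rw [← MonoidHom.range_eq_top, homF_range, hgh]

theorem closure_Glam : Subgroup.closure {Glam.a lam, Glam.b lam} = ⊤ := by
  set K := Subgroup.closure {Glam.a lam, Glam.b lam}
  have ha : Glam.a lam ∈ K := Subgroup.subset_closure (by simp)
  have hb : Glam.b lam ∈ K := Subgroup.subset_closure (by simp)
  let V : AddSubgroup (Rlam lam) :=
    { carrier := {r | (SemidirectProduct.inl (Multiplicative.ofAdd r) : Glam lam) ∈ K}
      zero_mem' := K.one_mem
      add_mem' := fun {r s} hr hs => by
        have := K.mul_mem hr hs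
        rwa [← map_mul, ← ofAdd_add] at this
      neg_mem' := fun {r} hr => by
        have := K.inv_mem hr
        rwa [← map_inv, ← ofAdd_neg] at this }
  have hpow : ∀ x ∈ Submonoid.closure ({(lam : ℂ), ((lam⁻¹ : ℂˣ) : ℂ)} : Set ℂ),
      ∃ n : ℤ, x = ((lam ^ n : ℂˣ) : ℂ) := by
    intro x hx
    induction hx using Submonoid.closure_induction with
    | mem x hx =>
      rcases hx with rfl | rfl
      · exact ⟨1, by simp⟩
      · exact ⟨-1, by simp⟩
    | one => exact ⟨0, by simp⟩
    | mul x y _ _ hx hy =>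
      obtain ⟨n, rfl⟩ := hx
      obtain ⟨m, rfl⟩ := hy
      exact ⟨n + m, by rw [zpow_add, Units.val_mul]⟩
  have hV : ∀ (r : ℂ) (hr : r ∈ Algebra.adjoin ℤ ({(lam : ℂ), ((lam⁻¹ : ℂˣ) : ℂ)} : Set ℂ)),
      ∃ s ∈ V, (s : ℂ) = r := by
    intro r hr
    rw [← Subalgebra.mem_toSubmodule, Algebra.adjoin_eq_span] at hr
    induction hr using Submodule.span_induction with
    | mem x hx =>
      obtain ⟨n, rfl⟩ := hpow x hx
      refine ⟨((Rlam.unit lam ^ n : (Rlam lam)ˣ) : Rlam lam), ?_, coe_unit_zpow n⟩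
      have h : Glam.a lam ^ n * Glam.b lam * (Glam.a lam ^ n)⁻¹ ∈ K :=
        K.mul_mem (K.mul_mem (K.zpow_mem ha n) hb) (K.inv_mem (K.zpow_mem ha n))
      change (SemidirectProduct.inl _ : Glam lam) ∈ K
      convert h using 1
      refine Glam_ext ?_ ?_
      · rw [lin_conj _ ex_b, lin_b, ex_zpow, ex_a, mul_one, mul_one]
        exact coe_unit_zpow n
      · rw [ex_mul, ex_mul, ex_inv, ex_b, add_zero, add_neg_cancel]
        rfl
    | zero => exact ⟨0, V.zero_mem, rfl⟩
    | add x y _ _ hx hy =>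
      obtain ⟨s, hs, rfl⟩ := hx
      obtain ⟨t, ht, rfl⟩ := hy
      exact ⟨s + t, V.add_mem hs ht, rfl⟩
    | smul n x _ hx =>
      obtain ⟨s, hs, rfl⟩ := hx
      exact ⟨n • s, V.zsmul_mem hs n, by simp⟩
  rw [eq_top_iff]
  rintro g -
  obtain ⟨s, hs, hsg⟩ := hV (lin g) g.left.toAdd.2
  have : g = SemidirectProduct.inl (Multiplicative.ofAdd s) * Glam.a lam ^ ex g := by
    refine Glam_ext ?_ ?_
    · have h0 : ∀ n : ℤ, lin (Glam.a lam ^ n) = 0 := by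
        intro n
        rw [Glam.a, ← map_zpow]
        rfl
      rw [lin_mul, h0, mul_zero, add_zero, ← hsg]
      rfl
    · rw [ex_mul, ex_zpow, ex_a, mul_one]
      exact (zero_add _).symm
  rw [this]
  exact K.mul_mem hs (K.zpow_mem ha _)

instance : Group.FG (Glam lam) :=
  Group.fg_of_surjective (homF_surjective (closure_Glam (lam := lam)))

theorem isEquationallyNoetherian_Glam : IsEquationallyNoetherian (Glam lam) := by
  -- The affine representation forgets the `ℤ`-component modulo the order of `λ` if `λ` is a root of
  -- unity; an extra diagonal entry `2^n` makes it faithful.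
  let two : ℂˣ := Units.mk0 2 two_ne_zero
  let ρ : Glam lam →* Matrix (Fin 3) (Fin 3) ℂ :=
    { toFun := fun g => !![((lam ^ ex g : ℂˣ) : ℂ), lin g, 0; 0, 1, 0; 0, 0, ((two ^ ex g : ℂˣ) : ℂ)]
      map_one' := by
        ext i j
        fin_cases i <;> fin_cases j <;> simp [ex_one, lin_one]
      map_mul' := fun g h => by
        ext i j
        fin_cases i <;> fin_cases j <;>
          simp [Matrix.mul_apply, Fin.sum_univ_three, ex_mul, lin_mul, zpow_add, add_comm] }
  refine isEquationallyNoetherian_of_injective_matrix ρ fun g h hgh => Glam_ext ?_ ?_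
  · have := congrFun (congrFun hgh 0) 1
    simpa [ρ] using this
  · have := congrFun (congrFun hgh 2) 2
    simp only [ρ, MonoidHom.coe_mk, OneHom.coe_mk, Matrix.of_apply, Matrix.cons_val] at this
    have h2 : (2 : ℝ) ^ ex g = 2 ^ ex h := by
      have h3 := congrArg norm this
      simpa [two] using h3
    exact zpow_right_injective₀ (by norm_num) (by norm_num) h2

end Glam

end KrullML
namespace KrullML

open scoped commutatorElement

/-! ### Pairs in `G(λ)` satisfying the relations of the standard generators -/

theorem exists_injective_of_ker_eq {A B C : Type*} [Group A] [Group B] [Group C] {f : A →* B}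
    {g : A →* C} (hf : Function.Surjective f) (h : f.ker = g.ker) :
    ∃ ι : B →* C, Function.Injective ι ∧ ∀ x, ι (f x) = g x := by
  let s := Function.surjInv hf
  have hs : Function.RightInverse s f := Function.rightInverse_surjInv hf
  have hι : ∀ x, f.liftOfRightInverse s hs ⟨g, h.le⟩ (f x) = g x := fun x =>
    MonoidHom.liftOfRightInverse_comp_apply f s hs ⟨g, h.le⟩ x
  refine ⟨f.liftOfRightInverse s hs ⟨g, h.le⟩, ?_, hι⟩
  rw [injective_iff_map_eq_one]
  intro b hb
  obtain ⟨x, rfl⟩ := hf b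
  rw [hι] at hb
  exact (h.symm.le hb : x ∈ f.ker)

section

variable {lam : ℂˣ}

theorem lin_a_zpow (n : ℤ) : lin (Glam.a lam ^ n) = 0 := by
  rw [Glam.a, ← map_zpow]
  rfl

/-- Comparing the linear parts of `g^n g` and `g g^n` gives the geometric sum without writing it
out. -/
theorem lin_zpow_mul (g : Glam lam) (n : ℤ) :
    lin (g ^ n) * (((lam ^ ex g : ℂˣ) : ℂ) - 1) =
      lin g * (((lam ^ (n * ex g) : ℂˣ) : ℂ) - 1) := by
  have h := congrArg lin ((Commute.refl g).zpow_left n).eq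
  rw [lin_mul, lin_mul, ex_zpow] at h
  linear_combination -h

theorem IsMinRoot.ne_one {P : Polynomial ℤ} {u v : ℂˣ} (hu : IsMinRoot P u) (hv : IsMinRoot P v)
    (h : u ≠ 1) : v ≠ 1 := by
  rintro rfl
  refine h (Units.ext ?_)
  have := (hu.ev_one_iff hv (Lx - 1)).2 (by rw [map_sub, ev_Lx, map_one]; simp)
  rw [map_sub, ev_Lx, map_one, sub_eq_zero] at this
  exact this

/-- The same `n` and `Q` describe `w` at both pairs. With `μ = λ^(ex α)`, the linear part at `(α,
β)` is `lin β · Q(μ, 1)` plus a geometric sum times `lin α`; the factor `μ - 1` avoids the division.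
-/
theorem exists_coordinates {α β : Glam lam} (hβ : ex β = 0) (w : F) : ∃ (n : ℤ) (Q : L),
    ex (homF (Glam.a lam) (Glam.b lam) w) = n ∧
    lin (homF (Glam.a lam) (Glam.b lam) w) = ev lam 1 Q ∧ ex (homF α β w) = n * ex α ∧
    (((lam ^ ex α : ℂˣ) : ℂ) - 1) * lin (homF α β w) =
      (((lam ^ ex α : ℂˣ) : ℂ) - 1) * lin β * ev (lam ^ ex α) 1 Q +
        lin α * (((lam ^ (n * ex α) : ℂˣ) : ℂ) - 1) := by
  have hx : ∀ (u : ℂˣ) (n : ℤ), ev u 1 (AddMonoidAlgebra.single (n, 0) 1) = ((u ^ n : ℂˣ) : ℂ) := by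
    intro u n
    rw [ev_single]; simp
  induction w using FreeGroup.induction_on with
  | C1 => exact ⟨0, 0, by simp [ex_one, lin_one]⟩
  | of i =>
    have hi : i = 0 ∨ i = 1 := by omega
    rcases hi with rfl | rfl
    · refine ⟨1, 0, ?_⟩
      change ex (homF _ _ fa) = _ ∧ lin (homF _ _ fa) = _ ∧ ex (homF _ _ fa) = _ ∧
        _ * lin (homF _ _ fa) = _
      rw [homF_fa, homF_fa, lin_a, ex_a]
      refine ⟨rfl, by simp, by simp, ?_⟩
      rw [map_zero, one_mul]; ring
    · refine ⟨0, 1, ?_⟩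
      change ex (homF _ _ fb) = _ ∧ lin (homF _ _ fb) = _ ∧ ex (homF _ _ fb) = _ ∧
        _ * lin (homF _ _ fb) = _
      rw [homF_fb, homF_fb, lin_b, ex_b, hβ]
      simp
  | inv_of i ih =>
    obtain ⟨n, Q, h1, h2, h3, h4⟩ := ih
    refine ⟨-n, -(AddMonoidAlgebra.single (-n, 0) 1 * Q), ?_, ?_, ?_, ?_⟩
    · rw [map_inv, ex_inv, h1]
    · rw [map_inv, lin_inv, h1, h2, map_neg, map_mul, hx]
    · rw [map_inv, ex_inv, h3]; ring
    · rw [map_inv, lin_inv, h3, map_neg, map_mul, hx, ← zpow_mul, mul_comm (ex α), neg_mul]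
      have h5 := val_zpow_mul_val_zpow_neg (lam := lam) (n * ex α)
      linear_combination -((lam ^ (-(n * ex α)) : ℂˣ) : ℂ) * h4 - lin α * h5
  | mul x y hx' hy =>
    obtain ⟨n, Q, h1, h2, h3, h4⟩ := hx'
    obtain ⟨n', Q', h1', h2', h3', h4'⟩ := hy
    refine ⟨n + n', Q + AddMonoidAlgebra.single (n, 0) 1 * Q', ?_, ?_, ?_, ?_⟩
    · rw [map_mul, ex_mul, h1, h1']
    · rw [map_mul, lin_mul, h1, h2, h2', map_add, map_mul, hx]
    · rw [map_mul, ex_mul, h3, h3']; ring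
    · rw [map_mul, lin_mul, h3, map_add, map_mul, hx, ← zpow_mul, mul_comm (ex α), add_mul,
        zpow_add, Units.val_mul]
      linear_combination h4 + ((lam ^ (n * ex α) : ℂˣ) : ℂ) * h4'

/-- A pair of elements of `G(λ)` satisfying the same relations as the pair of generators. -/
theorem ker_homF_eq (hlam : lam ≠ 1) {P : Polynomial ℤ} {α β : Glam lam} (hβ : ex β = 0)
    (hβ' : lin β ≠ 0) (h₁ : IsMinRoot P lam) (h₂ : IsMinRoot P (lam ^ ex α)) :
    (homF (Glam.a lam) (Glam.b lam)).ker = (homF α β).ker := by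
  have hμ := h₁.ne_one h₂ hlam
  have hμ' : ((lam ^ ex α : ℂˣ) : ℂ) - 1 ≠ 0 := fun h =>
    hμ (Units.ext (by simpa [sub_eq_zero] using h))
  have hα : ex α ≠ 0 := fun h => hμ (by rw [h, zpow_zero])
  ext w
  obtain ⟨n, Q, h1, h2, h3, h4⟩ := exists_coordinates (α := α) hβ w
  rw [MonoidHom.mem_ker, MonoidHom.mem_ker, eq_one_iff_lin_ex, eq_one_iff_lin_ex, h1, h2, h3,
    h₁.ev_one_iff h₂, mul_eq_zero, or_iff_left hα]
  refine and_congr_left fun hn => ?_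
  rw [hn, zero_mul, zpow_zero, Units.val_one, sub_self, mul_zero, add_zero, mul_assoc,
    mul_right_inj' hμ'] at h4
  rw [h4, mul_eq_zero, or_iff_right hβ']

/-! ### The group `M(λ)` -/

/-- The projection of `F` to `M(λ)`. -/
def mkM (lam : ℂˣ) : F →* Mlam lam := PresentedGroup.mk _

theorem mkM_surjective : Function.Surjective (mkM lam) := PresentedGroup.mk_surjective _

theorem mkM_eq_one {w : F}
    (hw : w ∈ (derivedSeries F 2 : Set F) ∪ {w | ∃ Q ∈ MlamIdeal lam, w = commPow Q}) :
    mkM lam w = 1 :=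
  (QuotientGroup.eq_one_iff w).2 (Subgroup.subset_normalClosure hw)

theorem derivedSeries_two_le_ker_mkM : derivedSeries F 2 ≤ (mkM lam).ker :=
  fun _ hw => mkM_eq_one (Or.inl hw)

theorem mkM_commPow_eq_one {Q : L} (hQ : Q ∈ MlamIdeal lam) : mkM lam (commPow Q) = 1 :=
  mkM_eq_one (Or.inr ⟨Q, hQ, rfl⟩)

instance : Group.FG (Mlam lam) := Group.fg_of_surjective (mkM_surjective (lam := lam))

theorem exists_hom_Mlam {g h : Glam lam}
    (hgh : ∀ Q ∈ MlamIdeal lam, ev (lam ^ ex g) (lam ^ ex h) Q = 0) :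
    ∃ φ : Mlam lam →* Glam lam, φ.comp (mkM lam) = homF g h := by
  have hrel : ∀ r ∈ (derivedSeries F 2 : Set F) ∪ {w | ∃ Q ∈ MlamIdeal lam, w = commPow Q},
      FreeGroup.lift ![g, h] r = 1 := by
    rintro r (hr | ⟨Q, hQ, rfl⟩)
    · exact derivedSeries_two_le_ker (homF g h) hr
    · change homF g h _ = 1
      rw [eq_one_iff_lin_ex]
      refine ⟨?_, ex_map_commPow _ _⟩
      rw [lin_map_commPow, homF_fa, homF_fb, hgh Q hQ, zero_mul]
  refine ⟨PresentedGroup.toGroup hrel, homF_ext ?_ ?_⟩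
  · rw [homF_fa]
    exact PresentedGroup.toGroup.of hrel (x := 0)
  · rw [homF_fb]
    exact PresentedGroup.toGroup.of hrel (x := 1)

/-- The linear part of the image of `c^Q` is `Q(λ^i, λ^j)` times that of `c`, which can be
cancelled. If both `λ^i` and `λ^j` were `1`, the commutator formula would give `0` for `c`. -/
theorem isExponent_of_hom (f : F →* Glam lam)
    (hf : ∀ Q ∈ MlamIdeal lam, f (commPow Q) = 1) (hc : f (fa * fb * fa⁻¹ * fb⁻¹) ≠ 1) :
    lin (f (fa * fb * fa⁻¹ * fb⁻¹)) ≠ 0 ∧ IsExponent lam (ex (f fa), ex (f fb)) := by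
  have hc' : lin (f (fa * fb * fa⁻¹ * fb⁻¹)) ≠ 0 := by
    intro h
    refine hc ((eq_one_iff_lin_ex _).2 ⟨h, ?_⟩)
    simp only [map_mul, map_inv]
    exact ex_commutator _ _
  refine ⟨hc', fun Q hQ => ?_, ?_⟩
  · have h := lin_map_commPow f Q
    rw [hf Q hQ, lin_one, eq_comm, mul_eq_zero] at h
    exact h.resolve_right hc'
  · by_contra! h
    refine hc' ?_
    simp only [map_mul, map_inv]
    rw [lin_commutator, h.1, h.2, Units.val_one, sub_self, zero_mul, zero_mul, add_zero]

theorem exists_hom_shift (lam : ℂˣ) (k : ℤ) : ∃ φ : Mlam lam →* Glam lam, φ.comp (mkM lam) =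
    homF (Glam.a lam) (Glam.b lam * Glam.a lam ^ (lamPeriod lam * k)) := by
  refine exists_hom_Mlam fun Q hQ => ?_
  rw [ex_mul, ex_zpow, ex_a, ex_b, zpow_one, mul_one, zero_add]
  exact ev_eq_zero_of_mem hQ k

/-- The homomorphism `a ↦ a`, `b ↦ b * a ^ (m * k)`, where `m` is the order of `λ` if this is finite
and `1` otherwise. -/
noncomputable def shiftHom (lam : ℂˣ) (k : ℤ) : Mlam lam →* Glam lam :=
  (exists_hom_shift lam k).choose

theorem shiftHom_mkM (k : ℤ) (w : F) : shiftHom lam k (mkM lam w) =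
    homF (Glam.a lam) (Glam.b lam * Glam.a lam ^ (lamPeriod lam * k)) w :=
  DFunLike.congr_fun (exists_hom_shift lam k).choose_spec w

theorem lin_b_mul_a_zpow (n : ℤ) : lin (Glam.b lam * Glam.a lam ^ n) = 1 := by
  rw [lin_mul, lin_b, lin_a_zpow, mul_zero, add_zero]

theorem ex_b_mul_a_zpow (n : ℤ) : ex (Glam.b lam * Glam.a lam ^ n) = n := by
  rw [ex_mul, ex_b, ex_zpow, ex_a, mul_one, zero_add]

theorem lin_homF_shift_commutator (n : ℤ) :
    lin (homF (Glam.a lam) (Glam.b lam * Glam.a lam ^ n) (fa * fb * fa⁻¹ * fb⁻¹)) = lam - 1 := by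
  simp only [map_mul, map_inv, homF_fa, homF_fb]
  rw [lin_commutator, lin_a, lin_b_mul_a_zpow, ex_a, zpow_one]
  ring

theorem ex_homF_normalForm (f : F →* Glam lam) (p q : ℤ) (Q : L) :
    ex (f (fa ^ p * fb ^ q * commPow Q)) = ex (f fa) * p + ex (f fb) * q := by
  rw [map_mul, map_mul, ex_mul, ex_mul, ex_map_commPow, map_zpow, map_zpow, ex_zpow, ex_zpow]
  ring

theorem coe_sub_one_ne_zero (hlam : lam ≠ 1) : (lam : ℂ) - 1 ≠ 0 := fun h =>
  hlam (Units.ext (by simpa [sub_eq_zero] using h))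

/-- On `a^p b^q c^Q` the `ℤ`-component is `p + mkq`, which vanishes for at most one `k` unless `p =
q = 0`. In that case the condition is `Q(λ, λ^(mk)) = 0` with `Q` outside the ideal. -/
theorem finite_setOf_shiftHom_eq_one (hlam : lam ≠ 1) {x : Mlam lam} (hx : x ≠ 1) :
    {k : ℤ | shiftHom lam k x = 1}.Finite := by
  obtain ⟨w, rfl⟩ := mkM_surjective x
  obtain ⟨p, q, Q, hw⟩ := exists_map_eq_zpow_mul_commPow derivedSeries_two_le_ker_mkM w
  have hex : ∀ k, shiftHom lam k (mkM lam w) = 1 → p + lamPeriod lam * k * q = 0 := by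
    intro k hk
    rw [hw, shiftHom_mkM] at hk
    have h := ((eq_one_iff_lin_ex _).1 hk).2
    rwa [ex_homF_normalForm, homF_fa, homF_fb, ex_a, ex_b_mul_a_zpow, one_mul] at h
  by_cases hpq : p = 0 ∧ q = 0
  · obtain ⟨rfl, rfl⟩ := hpq
    rw [zpow_zero, zpow_zero, one_mul, one_mul] at hw
    rw [hw] at hx ⊢
    have hQ : Q ∉ MlamIdeal lam := fun h => hx (mkM_commPow_eq_one h)
    refine (finite_setOf_ev_eq_zero hQ).subset fun k hk => ?_
    have h := ((eq_one_iff_lin_ex _).1 ((shiftHom_mkM k _).symm.trans hk)).1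
    rw [lin_map_commPow, homF_fa, homF_fb, ex_a, ex_b_mul_a_zpow, zpow_one,
      lin_homF_shift_commutator, mul_eq_zero] at h
    exact h.resolve_right (coe_sub_one_ne_zero hlam)
  · refine Set.Subsingleton.finite fun k hk l hl => ?_
    have h1 := hex k hk
    have h2 := hex l hl
    have hq : q ≠ 0 := by
      rintro rfl
      exact hpq ⟨by simpa using h1, rfl⟩
    have h3 : lamPeriod lam * q * (k - l) = 0 := by linear_combination h1 - h2
    rw [mul_eq_zero, mul_eq_zero, sub_eq_zero] at h3
    exact (h3.resolve_left (by simp [lamPeriod_ne_zero, hq]))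

/-! ### Comparison of `M(λ)` with `G(λ)` -/

theorem isFullyResidually_Mlam_Glam (hlam : lam ≠ 1) : IsFullyResidually (Mlam lam) (Glam lam) := by
  intro E hE
  have hfin : (⋃ e ∈ E, {k : ℤ | shiftHom lam k e = 1}).Finite :=
    E.finite_toSet.biUnion fun e he =>
      finite_setOf_shiftHom_eq_one hlam (ne_of_mem_of_not_mem he hE)
  obtain ⟨k, hk⟩ := hfin.exists_notMem
  refine ⟨shiftHom lam k, fun e he h => hk ?_⟩
  exact Set.mem_biUnion he h

/-- The embedding is `a ↦ a`, `b ↦ c`. After every shift homomorphism the pair satisfies exactly the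
relations of the standard generators, because `c` goes to an element over `0` with linear part `λ -
1 ≠ 0`. As infinitely many shifts kill only `1`, this holds already in `M(λ)`. -/
theorem exists_injective_Glam_Mlam (hlam : lam ≠ 1) :
    ∃ ι : Glam lam →* Mlam lam, Function.Injective ι := by
  have hker : (homF (Glam.a lam) (Glam.b lam)).ker =
      (homF (mkM lam fa) (mkM lam (fa * fb * fa⁻¹ * fb⁻¹))).ker := by
    have hcomp : ∀ k, (homF (Glam.a lam) (Glam.b lam)).ker =
        ((shiftHom lam k).comp (homF (mkM lam fa) (mkM lam (fa * fb * fa⁻¹ * fb⁻¹)))).ker := by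
      intro k
      have h1 : (shiftHom lam k).comp (homF (mkM lam fa) (mkM lam (fa * fb * fa⁻¹ * fb⁻¹))) =
          homF (Glam.a lam) (shiftHom lam k (mkM lam (fa * fb * fa⁻¹ * fb⁻¹))) := by
        refine homF_ext ?_ ?_
        · rw [MonoidHom.comp_apply, homF_fa, homF_fa, shiftHom_mkM, homF_fa]
        · rw [MonoidHom.comp_apply, homF_fb, homF_fb]
      rw [h1]
      refine ker_homF_eq hlam ?_ ?_ (isMinRoot_lamPoly lam) ?_
      · rw [shiftHom_mkM]
        exact ex_eq_zero_of_mem_derivedSeries_one _ (commutator_mem_derivedSeries_one _ _)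
      · rw [shiftHom_mkM, lin_homF_shift_commutator]
        exact coe_sub_one_ne_zero hlam
      · rw [ex_a, zpow_one]
        exact isMinRoot_lamPoly lam
    ext w
    constructor
    · intro hw
      rw [MonoidHom.mem_ker]
      by_contra hne
      refine (Set.infinite_univ (α := ℤ)).mono (fun k _ => ?_)
        (finite_setOf_shiftHom_eq_one hlam hne)
      exact (hcomp k).le hw
    · intro hw
      refine (hcomp 0).symm.le ?_
      rw [MonoidHom.mem_ker] at hw ⊢
      rw [MonoidHom.comp_apply, hw, map_one]
  obtain ⟨ι, hι, -⟩ := exists_injective_of_ker_eq (homF_surjective closure_Glam) hker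
  exact ⟨ι, hι⟩

theorem universalTheory_Glam_eq (hlam : lam ≠ 1) :
    universalTheory (Glam lam) = universalTheory (Mlam lam) := by
  obtain ⟨ι, hι⟩ := exists_injective_Glam_Mlam hlam
  exact (isFullyResidually_Mlam_Glam hlam).universalTheory_subset.antisymm
    (isFullyResidually_of_injective ι hι).universalTheory_subset

theorem isEquationallyNoetherian_Mlam (hlam : lam ≠ 1) : IsEquationallyNoetherian (Mlam lam) := by
  refine isEquationallyNoetherian_Glam.of_residually (H := Glam lam) fun x hx => ?_
  obtain ⟨ψ, hψ⟩ := isFullyResidually_Mlam_Glam hlam {x} (by simpa using hx.symm)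
  exact ⟨ψ, hψ x (Finset.mem_singleton_self x)⟩

theorem shiftHom_zero_mkM (w : F) :
    shiftHom lam 0 (mkM lam w) = homF (Glam.a lam) (Glam.b lam) w := by
  rw [shiftHom_mkM, mul_zero, zpow_zero, mul_one]

theorem shiftHom_zero_surjective : Function.Surjective (shiftHom lam 0) := by
  intro g
  obtain ⟨w, rfl⟩ := homF_surjective closure_Glam g
  exact ⟨mkM lam w, shiftHom_zero_mkM w⟩

/-- The witness is killed by the shift `0` but not by the shift `1`. For a root of unity of order
`m` it is `(ba)^m a^(-m)`, with a vanishing geometric sum in the first case and `ℤ`-component `m²`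
in the second. Otherwise it is `[b, c]`, whose linear part becomes `(λ - 1)²`. -/
theorem ker_shiftHom_zero_ne_bot (hlam : lam ≠ 1) : (shiftHom lam 0).ker ≠ ⊥ := by
  suffices h : ∃ w, shiftHom lam 0 (mkM lam w) = 1 ∧ shiftHom lam 1 (mkM lam w) ≠ 1 by
    obtain ⟨w, h0, h1⟩ := h
    intro hbot
    have : mkM lam w ∈ (shiftHom lam 0).ker := h0
    rw [hbot, Subgroup.mem_bot] at this
    exact h1 (by rw [this, map_one])
  by_cases hfin : IsOfFinOrder lam
  · refine ⟨(fb * fa) ^ (orderOf lam : ℤ) * fa ^ (-(orderOf lam : ℤ)), ?_, ?_⟩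
    · rw [shiftHom_zero_mkM, eq_one_iff_lin_ex]
      simp only [map_mul, map_zpow, homF_fa, homF_fb]
      constructor
      · rw [lin_mul, lin_a_zpow, mul_zero, add_zero]
        have h := lin_zpow_mul (Glam.b lam * Glam.a lam) (orderOf lam)
        rw [ex_mul, ex_a, ex_b, zero_add, mul_one, zpow_one, zpow_natCast lam, pow_orderOf_eq_one,
          Units.val_one, sub_self, mul_zero, mul_eq_zero] at h
        exact h.resolve_right (coe_sub_one_ne_zero hlam)
      · rw [ex_mul, ex_zpow, ex_zpow, ex_mul, ex_a, ex_b]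
        ring
    · rw [shiftHom_mkM, Ne, eq_one_iff_lin_ex]
      simp only [map_mul, map_zpow, homF_fa, homF_fb]
      rw [ex_mul, ex_zpow, ex_zpow, ex_mul, ex_b_mul_a_zpow, ex_a, lamPeriod, if_pos hfin]
      rintro ⟨-, h⟩
      have h0 := hfin.orderOf_pos.ne'
      have : (orderOf lam : ℤ) * orderOf lam = 0 := by linear_combination h
      simp [h0] at this
  · refine ⟨fb * (fa * fb * fa⁻¹ * fb⁻¹) * fb⁻¹ * (fa * fb * fa⁻¹ * fb⁻¹)⁻¹, ?_, ?_⟩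
    · rw [shiftHom_zero_mkM, map_mul, map_mul, map_mul, map_inv, map_inv, homF_fb]
      refine commutatorElement_eq_one_iff_commute.2 (commute_of_ex_eq_zero ex_b ?_)
      exact ex_eq_zero_of_mem_derivedSeries_one _ (commutator_mem_derivedSeries_one _ _)
    · rw [shiftHom_mkM, map_mul, map_mul _ _ fb⁻¹, map_mul _ fb, map_inv, map_inv, homF_fb, Ne,
        eq_one_iff_lin_ex, lin_commutator, ex_b_mul_a_zpow, lin_homF_shift_commutator,
        ex_eq_zero_of_mem_derivedSeries_one _ (commutator_mem_derivedSeries_one _ _), lamPeriod,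
        if_neg hfin]
      rintro ⟨h, -⟩
      exact coe_sub_one_ne_zero hlam (by simpa using h)

end

end KrullML
namespace KrullML

open scoped commutatorElement

/-! ### Proper quotients of `M(λ)` with the same universal theory -/

section

variable {lam : ℂˣ}

theorem map_commPow_eq_one_of_commutator {H : Type*} [Group H] {f : F →* H}
    (hf : derivedSeries F 2 ≤ f.ker) (hc : f (fa * fb * fa⁻¹ * fb⁻¹) = 1) (Q : L) :
    f (commPow Q) = 1 := by
  induction Q using AddMonoidAlgebra.induction_linear with
  | zero => exact map_commPow_zero
  | add Q R hQ hR => rw [map_commPow_add hf, hQ, hR, one_mul]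
  | single p n =>
    rw [commPow_single p.1 p.2, map_mul, map_mul, map_zpow, hc, one_zpow, mul_one, map_inv,
      mul_inv_cancel]

/-- Two homomorphisms of the same type have the same kernel. -/
theorem eq_one_of_sameType {N : Type*} [Group N] {f : F →* N} (hf : derivedSeries F 2 ≤ f.ker)
    {ψ ψ' : N →* Glam lam} (hψ : lin (ψ (f (fa * fb * fa⁻¹ * fb⁻¹))) ≠ 0)
    (hψ' : lam ^ ex (ψ' (f fa)) ≠ 1 ∨ lam ^ ex (ψ' (f fb)) ≠ 1)
    (h : SameType lam (ex (ψ (f fa)), ex (ψ (f fb))) (ex (ψ' (f fa)), ex (ψ' (f fb))))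
    {w : F} (hw : ψ (f w) = 1) : ψ' (f w) = 1 := by
  have hex : ex (ψ' (f w)) = 0 := by
    obtain ⟨p, q, Q, hpq⟩ := exists_map_eq_zpow_mul_commPow hf w
    have h1 := ex_homF_normalForm (ψ.comp f) p q Q
    have h2 := ex_homF_normalForm (ψ'.comp f) p q Q
    simp only [MonoidHom.comp_apply, ← hpq] at h1 h2
    rw [hw, ex_one] at h1
    rw [h2]
    exact h.2 p q h1.symm
  -- `[w, z]` is some `c^Q`, so `ψ (f w) = 1` forces `Q` to vanish at the exponent of `ψ`, hence at
  -- that of `ψ'`. Now `ψ'` also kills `[w, z]`, and the commutator formula applies.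
  have hcomm : ∀ z : F, (1 - ((lam ^ ex (ψ' (f z)) : ℂˣ) : ℂ)) * lin (ψ' (f w)) = 0 := by
    intro z
    obtain ⟨Q, hQ⟩ := exists_map_eq_commPow hf (commutator_mem_derivedSeries_one w z)
    have h0 : ψ (f (commPow Q)) = 1 := by
      rw [← hQ]
      simp only [map_mul, map_inv, hw]
      group
    have h1 := lin_map_commPow (ψ.comp f) Q
    have h2 := lin_map_commPow (ψ'.comp f) Q
    simp only [MonoidHom.comp_apply] at h1 h2
    rw [← hQ] at h2
    rw [h0, lin_one, eq_comm, mul_eq_zero] at h1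
    have h3 := h.1 Q (h1.resolve_right hψ)
    rw [h3, zero_mul] at h2
    simp only [map_mul, map_inv] at h2
    rw [lin_commutator, hex, zpow_zero, Units.val_one, sub_self, zero_mul, add_zero] at h2
    exact h2
  have hne : ∀ u : ℂˣ, u ≠ 1 → (1 : ℂ) - u ≠ 0 := fun u hu h =>
    hu (Units.ext (sub_eq_zero.1 h).symm)
  refine (eq_one_iff_lin_ex _).2 ⟨?_, hex⟩
  rcases hψ' with h' | h'
  · exact (mul_eq_zero.1 (hcomm fa)).resolve_left (hne _ h')
  · exact (mul_eq_zero.1 (hcomm fb)).resolve_left (hne _ h')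

/-- The Euclidean algorithm for pairs of generators. -/
theorem exists_closure_pair_map_eq_one {N : Type*} [Group N] (e : N →* Multiplicative ℤ)
    (α β : N) (h : Subgroup.closure {α, β} = ⊤) :
    ∃ α' β' : N, Subgroup.closure {α', β'} = ⊤ ∧ e β' = 1 := by
  induction hn : (e β).toAdd.natAbs using Nat.strong_induction_on generalizing α β with
  | _ n ih =>
    by_cases h0 : (e β).toAdd = 0
    · exact ⟨α, β, h, h0⟩
    · let k := (e α).toAdd / (e β).toAdd
      have hcl : Subgroup.closure {β, α * β ^ (-k)} = ⊤ := by
        rw [eq_top_iff, ← h, Subgroup.closure_le]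
        have h1 : β ∈ Subgroup.closure {β, α * β ^ (-k)} := Subgroup.subset_closure (by simp)
        have h2 : α * β ^ (-k) ∈ Subgroup.closure {β, α * β ^ (-k)} :=
          Subgroup.subset_closure (by simp)
        rintro x (rfl | rfl)
        · have := Subgroup.mul_mem _ h2 (Subgroup.zpow_mem _ h1 k)
          rwa [mul_assoc, ← zpow_add, neg_add_cancel, zpow_zero, mul_one] at this
        · exact h1
      refine ih _ ?_ β (α * β ^ (-k)) hcl rfl
      have h1 : (e (α * β ^ (-k))).toAdd = (e α).toAdd % (e β).toAdd := by
        rw [map_mul, map_zpow, toAdd_mul, toAdd_zpow, smul_eq_mul, Int.emod_def]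
        ring
      rw [h1, ← hn]
      have h2 := Int.emod_nonneg (e α).toAdd h0
      have h3 := Int.emod_lt_abs (e α).toAdd h0
      rw [Int.abs_eq_natAbs] at h3
      omega

theorem map_commutator_mkM_ne_one (hlam : lam ≠ 1) :
    mkM lam (fa * fb * fa⁻¹ * fb⁻¹) ≠ 1 := by
  intro h
  have h1 := congrArg (fun x => lin (shiftHom lam 0 x)) h
  simp only [map_one] at h1
  rw [shiftHom_mkM, lin_homF_shift_commutator, lin_one] at h1
  exact coe_sub_one_ne_zero hlam h1

/-- If `c` died, `N` would be abelian; but commutativity is a universal property that `M(λ)` does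
not have. -/
theorem map_commutator_ne_one_of_universalTheory (hlam : lam ≠ 1) {N : Type} [Group N] {f : F →* N}
    (hf : Function.Surjective f) (hf₂ : derivedSeries F 2 ≤ f.ker)
    (hN : universalTheory N ⊆ universalTheory (Mlam lam)) : f (fa * fb * fa⁻¹ * fb⁻¹) ≠ 1 := by
  intro hc
  obtain ⟨v, -, hv⟩ := exists_solution_of_universalTheory_subset hN ∅
    {fa * fb * fa⁻¹ * fb⁻¹} ![mkM lam fa, mkM lam fb] (by simp) (by
      intro w hw
      rw [Finset.mem_singleton.1 hw]
      have : homF (mkM lam fa) (mkM lam fb) = mkM lam :=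
        homF_ext (homF_fa _ _) (homF_fb _ _)
      change homF (mkM lam fa) (mkM lam fb) _ ≠ 1
      rw [this]
      exact map_commutator_mkM_ne_one hlam)
  refine hv _ (Finset.mem_singleton_self _) ?_
  obtain ⟨x, hx⟩ := hf (v 0)
  obtain ⟨y, hy⟩ := hf (v 1)
  have hval : FreeGroup.lift v (fa * fb * fa⁻¹ * fb⁻¹) = f (x * y * x⁻¹ * y⁻¹) := by
    simp [fa, fb, hx, hy]
  obtain ⟨Q, hQ⟩ := exists_map_eq_commPow hf₂ (commutator_mem_derivedSeries_one x y)
  rw [hval, hQ, map_commPow_eq_one_of_commutator hf₂ hc]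

/-- Homomorphisms that do not kill `c` have finitely many kernels, one for each type. Were these all
non-trivial, a set with one non-trivial element of each kernel and `c` would contradict residuality.
-/
theorem exists_injective_of_quotient {N : Type} [Group N] {ρ : Mlam lam →* N}
    (hker : ρ.ker ≠ ⊥) (hres : IsFullyResidually N (Glam lam))
    (hc : ρ (mkM lam (fa * fb * fa⁻¹ * fb⁻¹)) ≠ 1) (hρ : Function.Surjective ρ) :
    ∃ ψ : N →* Glam lam, Function.Injective ψ := by
  classical
  let f : F →* N := ρ.comp (mkM lam)
  have hf₂ : derivedSeries F 2 ≤ f.ker := fun w hw => by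
    rw [MonoidHom.mem_ker, MonoidHom.comp_apply, derivedSeries_two_le_ker_mkM hw, map_one]
  have hfs : Function.Surjective f := hρ.comp mkM_surjective
  obtain ⟨⟨x, hx⟩, hne⟩ := Subgroup.ne_bot_iff_exists_ne_one.1 hker
  have hx1 : x ≠ 1 := fun h => hne (Subtype.ext h)
  obtain ⟨w, hw⟩ := mkM_surjective x
  obtain ⟨p, q, Q, hpq⟩ := exists_map_eq_zpow_mul_commPow derivedSeries_two_le_ker_mkM w
  have hfw : f (fa ^ p * fb ^ q * commPow Q) = 1 := by
    rw [MonoidHom.comp_apply, ← hpq, hw]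
    exact hx
  obtain ⟨D, κ, hD⟩ := exists_finite_types lam (p := p) (q := q) (Q := Q) (by
    rintro rfl rfl hQ
    refine hx1 ?_
    rw [← hw, hpq, zpow_zero, zpow_zero, one_mul, one_mul, mkM_commPow_eq_one hQ])
  let X : (N →* Glam lam) → ℤ × ℤ := fun ψ => (ex (ψ (f fa)), ex (ψ (f fb)))
  have hX : ∀ ψ : N →* Glam lam, ψ (f (fa * fb * fa⁻¹ * fb⁻¹)) ≠ 1 →
      lin (ψ (f (fa * fb * fa⁻¹ * fb⁻¹))) ≠ 0 ∧ IsExponent lam (X ψ) ∧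
      (X ψ).1 * p + (X ψ).2 * q = 0 ∧
      (p = 0 → q = 0 → ev (lam ^ (X ψ).1) (lam ^ (X ψ).2) Q = 0) := by
    intro ψ hψ
    obtain ⟨h1, h2⟩ := isExponent_of_hom (ψ.comp f) (fun Q hQ => by
      simp only [f, MonoidHom.comp_apply]
      rw [mkM_commPow_eq_one hQ, map_one, map_one]) hψ
    have h3 := ex_homF_normalForm (ψ.comp f) p q Q
    rw [MonoidHom.comp_apply, hfw, map_one, ex_one] at h3
    refine ⟨h1, h2, h3.symm, ?_⟩
    rintro rfl rfl
    have h4 := lin_map_commPow (ψ.comp f) Q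
    rw [zpow_zero, zpow_zero, one_mul, one_mul] at hfw
    rw [MonoidHom.comp_apply, hfw, map_one, lin_one, eq_comm, mul_eq_zero] at h4
    exact h4.resolve_right h1
  by_contra! hno
  have hy : ∀ d : ℤ × ℤ, ∃ y : N, y ≠ 1 ∧ ∀ ψ : N →* Glam lam,
      ψ (f (fa * fb * fa⁻¹ * fb⁻¹)) ≠ 1 → d ∈ D → κ (X ψ) d → ψ y = 1 := by
    intro d
    by_cases hd : d ∈ D ∧ ∃ ψ : N →* Glam lam, ψ (f (fa * fb * fa⁻¹ * fb⁻¹)) ≠ 1 ∧ κ (X ψ) d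
    · obtain ⟨hdD, ψ, hψ, hψd⟩ := hd
      have hinj := hno ψ
      rw [injective_iff_map_eq_one] at hinj
      push Not at hinj
      obtain ⟨y, hy, hy1⟩ := hinj
      refine ⟨y, hy1, fun ψ' hψ' _ hψ'd => ?_⟩
      obtain ⟨u, rfl⟩ := hfs y
      obtain ⟨h1, h2, h3, h4⟩ := hX ψ hψ
      obtain ⟨-, h2', h3', h4'⟩ := hX ψ' hψ'
      exact eq_one_of_sameType hf₂ h1 h2'.2
        ((hD _ h2 h3 h4).2 _ h2' h3' h4' d hdD hψd hψ'd) hy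
    -- A type that does not occur imposes nothing; `c` serves as a non-trivial filler.
    · refine ⟨f (fa * fb * fa⁻¹ * fb⁻¹), hc, fun ψ hψ hdD hψd => ?_⟩
      exact absurd ⟨hdD, ψ, hψ, hψd⟩ hd
  choose y hy1 hy using hy
  obtain ⟨ψ, hψ⟩ := hres (insert (f (fa * fb * fa⁻¹ * fb⁻¹)) (D.image y)) (by
    rw [Finset.mem_insert, Finset.mem_image]
    rintro (h | ⟨d, -, h⟩)
    · exact hc h.symm
    · exact hy1 d h)
  have hψc := hψ _ (Finset.mem_insert_self _ _)
  obtain ⟨-, h2, h3, h4⟩ := hX ψ hψc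
  obtain ⟨d, hdD, hd⟩ := (hD _ h2 h3 h4).1
  exact hψ (y d) (Finset.mem_insert_of_mem (Finset.mem_image_of_mem y hdD)) (hy d ψ hψc hdD hd)

/-- A proper quotient of `M(λ)` with the same universal theory is isomorphic to `G(λ)`. -/
theorem nonempty_mulEquiv_Glam (hlam : lam ≠ 1) {N : Type} [Group N] {ρ : Mlam lam →* N}
    (hρ : Function.Surjective ρ) (hker : ρ.ker ≠ ⊥)
    (hN : universalTheory N = universalTheory (Mlam lam)) : Nonempty (N ≃* Glam lam) := by
  have hfg : Group.FG N := Group.fg_of_surjective hρ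
  let f : F →* N := ρ.comp (mkM lam)
  have hf₂ : derivedSeries F 2 ≤ f.ker := fun w hw => by
    rw [MonoidHom.mem_ker, MonoidHom.comp_apply, derivedSeries_two_le_ker_mkM hw, map_one]
  have hfs : Function.Surjective f := hρ.comp mkM_surjective
  have hc := map_commutator_ne_one_of_universalTheory hlam hfs hf₂ hN.le
  obtain ⟨ψ, hψ⟩ := exists_injective_of_quotient hker
    (isEquationallyNoetherian_Glam.isFullyResidually
      ((universalTheory_Glam_eq hlam).trans hN.symm).le) hc hρ
  obtain ⟨-, hexp⟩ := isExponent_of_hom (ψ.comp f) (fun Q hQ => by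
    simp only [f, MonoidHom.comp_apply]
    rw [mkM_commPow_eq_one hQ, map_one, map_one])
    (fun h => hc ((map_eq_one_iff ψ hψ).1 h))
  have hgen : Subgroup.closure {f fa, f fb} = ⊤ := by
    rw [← homF_range, homF_ext (homF_fa _ _) (homF_fb _ _), MonoidHom.range_eq_top]
    exact hfs
  obtain ⟨α, β, hαβ, hβ⟩ := exists_closure_pair_map_eq_one
    ((SemidirectProduct.rightHom (φ := lamAction lam)).comp ψ) _ _ hgen
  replace hβ : ex (ψ β) = 0 := hβ
  -- As `β` lies over `0`, the exponents of all elements are multiples of that of `α`, in particular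
  -- those of the original generators.
  have hdvd : ∀ n : N, ex (ψ α) ∣ ex (ψ n) := by
    intro n
    have hn : n ∈ Subgroup.closure {α, β} := hαβ ▸ Subgroup.mem_top n
    induction hn using Subgroup.closure_induction with
    | mem x hx =>
      rcases hx with rfl | rfl
      · exact dvd_rfl
      · rw [hβ]; exact dvd_zero _
    | one => rw [map_one, ex_one]; exact dvd_zero _
    | mul x y _ _ hx hy => rw [map_mul, ex_mul]; exact dvd_add hx hy
    | inv x _ hx => rw [map_inv, ex_inv]; exact hx.neg_right
  obtain ⟨γ, hγβ, hγ⟩ : ∃ γ : N, Subgroup.closure {γ, β} = ⊤ ∧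
      IsMinRoot (lamPoly lam) (lam ^ ex (ψ γ)) := by
    rcases hexp.isMinRoot_zpow (hdvd _) (hdvd _) with h | h
    · exact ⟨α, hαβ, h⟩
    · refine ⟨α⁻¹, ?_, by rwa [map_inv, ex_inv]⟩
      rw [eq_top_iff, ← hαβ, Subgroup.closure_le]
      rintro x (rfl | rfl)
      · exact (Subgroup.inv_mem_iff _).1 (Subgroup.subset_closure (by simp))
      · exact Subgroup.subset_closure (by simp)
  -- Otherwise `N` would be generated by `γ`, whose exponent is non-zero; but `c` has exponent `0`
  -- and is non-trivial.
  have hβ0 : lin (ψ β) ≠ 0 := by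
    intro h0
    have hβ1 : β = 1 := (map_eq_one_iff ψ hψ).1 ((eq_one_iff_lin_ex _).2 ⟨h0, hβ⟩)
    have hmem : f (fa * fb * fa⁻¹ * fb⁻¹) ∈ Subgroup.closure {γ, β} :=
      hγβ ▸ Subgroup.mem_top _
    rw [hβ1, Set.pair_comm, Subgroup.closure_insert_one, Subgroup.mem_closure_singleton] at hmem
    obtain ⟨n, hn⟩ := hmem
    have h1 : ex (ψ (f (fa * fb * fa⁻¹ * fb⁻¹))) = 0 := by
      simp only [map_mul, map_inv]
      exact ex_commutator _ _
    rw [← hn, map_zpow, ex_zpow, mul_eq_zero] at h1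
    rcases h1 with h1 | h1
    · rw [h1, zpow_zero] at hn
      exact hc hn.symm
    · exact (isMinRoot_lamPoly lam).ne_one hγ hlam (by rw [h1, zpow_zero])
  have hkereq : (homF (Glam.a lam) (Glam.b lam)).ker = (homF γ β).ker := by
    rw [ker_homF_eq hlam hβ hβ0 (isMinRoot_lamPoly lam) hγ]
    have : homF (ψ γ) (ψ β) = ψ.comp (homF γ β) := homF_ext
      (by rw [homF_fa, MonoidHom.comp_apply, homF_fa])
      (by rw [homF_fb, MonoidHom.comp_apply, homF_fb])
    ext w
    rw [this, MonoidHom.mem_ker, MonoidHom.mem_ker, MonoidHom.comp_apply, map_eq_one_iff ψ hψ]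
  obtain ⟨ι, hι, hι'⟩ := exists_injective_of_ker_eq (homF_surjective closure_Glam) hkereq
  refine ⟨(MulEquiv.ofBijective ι ⟨hι, fun n => ?_⟩).symm⟩
  obtain ⟨w, rfl⟩ := homF_surjective hγβ n
  exact ⟨_, hι' w⟩

end

/-! ### Chains of quotients -/

theorem ker_comp_ne_bot {A B C : Type*} [Group A] [Group B] [Group C] {f : A →* B} {g : B →* C}
    (hf : Function.Surjective f) (hg : g.ker ≠ ⊥) : (g.comp f).ker ≠ ⊥ := by
  intro h
  refine hg ((Subgroup.eq_bot_iff_forall _).2 fun y hy => ?_)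
  obtain ⟨x, rfl⟩ := hf y
  have : x ∈ (g.comp f).ker := hy
  rw [h, Subgroup.mem_bot] at this
  rw [this, map_one]

theorem QuotientChain.nonempty_mulEquiv {lam : ℂˣ} (hlam : lam ≠ 1) {n : ℕ}
    (C : QuotientChain (Mlam lam) (n + 1)) :
    Nonempty (C.Q ⟨1, Nat.succ_lt_succ n.succ_pos⟩ ≃* Glam lam) :=
  nonempty_mulEquiv_Glam hlam
    (ρ := (C.map ⟨0, n.succ_pos⟩).comp C.start.symm.toMonoidHom)
    ((C.surjective ⟨0, n.succ_pos⟩).comp C.start.symm.surjective)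
    (ker_comp_ne_bot C.start.symm.surjective (C.proper ⟨0, n.succ_pos⟩)) (C.theory_eq _)

/-- The second and the third group of a longer chain are both proper quotients of `M(λ)`, hence
copies of `G(λ)`. The map between them would contradict the Hopf property. -/
theorem QuotientChain.length_le_one {lam : ℂˣ} (hlam : lam ≠ 1) {n : ℕ}
    (C : QuotientChain (Mlam lam) n) : n ≤ 1 := by
  by_contra! hn
  obtain ⟨m, rfl⟩ := Nat.exists_eq_add_of_le' hn
  have h0 : 0 < m + 2 := by omega
  have h1 : 1 < m + 2 := by omega
  obtain ⟨e₁⟩ := C.nonempty_mulEquiv hlam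
  let f₁ : C.Q ⟨1, by omega⟩ →* C.Q ⟨2, by omega⟩ := C.map ⟨1, h1⟩
  let f₀ : Mlam lam →* C.Q ⟨1, by omega⟩ := (C.map ⟨0, h0⟩).comp C.start.symm.toMonoidHom
  have hf₁ : Function.Surjective f₁ := C.surjective ⟨1, h1⟩
  have hf₀ : Function.Surjective f₀ := (C.surjective ⟨0, h0⟩).comp C.start.symm.surjective
  have hk : f₁.ker ≠ ⊥ := C.proper ⟨1, h1⟩
  obtain ⟨e₂⟩ := nonempty_mulEquiv_Glam hlam (ρ := f₁.comp f₀) (hf₁.comp hf₀)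
    (ker_comp_ne_bot hf₀ hk) (C.theory_eq _)
  have hinj := isEquationallyNoetherian_Glam.injective_of_surjective
    ((e₂.toMonoidHom.comp f₁).comp e₁.symm.toMonoidHom)
    ((e₂.surjective.comp hf₁).comp e₁.symm.surjective)
  refine hk ((Subgroup.eq_bot_iff_forall _).2 fun y hy => ?_)
  refine e₁.injective (hinj ?_)
  simp only [MonoidHom.comp_apply, MulEquiv.toMonoidHom_eq_coe, MonoidHom.coe_coe,
    MulEquiv.symm_apply_apply, map_one]
  rw [MonoidHom.mem_ker.1 hy, map_one]

/-- The chain of length one given by a proper quotient with the same universal theory. -/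
def QuotientChain.ofHom {G H : Type} [hG : Group G] [hH : Group H] (π : G →* H)
    (hπ : Function.Surjective π) (hker : π.ker ≠ ⊥)
    (h : universalTheory H = universalTheory G) : QuotientChain G 1 where
  Q i := match i with
    | 0 => G
    | 1 => H
  group i := match i with
    | 0 => hG
    | 1 => hH
  start := MulEquiv.refl G
  map i := match i with
    | 0 => π
  surjective i := match i with
    | 0 => hπ
  proper i := match i with
    | 0 => hker
  theory_eq i := match i with
    | 0 => rfl
    | 1 => h

end KrullML

theorem mainTheorem7 (lam : ℂˣ) (hlam : lam ≠ 1) :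
    KrullML.HasKrullDimension (KrullML.Mlam lam) 1 ∧
    (∃ π : KrullML.Mlam lam →* KrullML.Glam lam,
      π (KrullML.Mlam.a lam) = KrullML.Glam.a lam ∧
      π (KrullML.Mlam.b lam) = KrullML.Glam.b lam ∧
      Function.Surjective π ∧ π.ker ≠ ⊥ ∧
      KrullML.universalTheory (KrullML.Glam lam) = KrullML.universalTheory (KrullML.Mlam lam)) ∧
    (∀ C : KrullML.QuotientChain (KrullML.Mlam lam) 1,
      Nonempty (C.Q 1 ≃* KrullML.Glam lam)) := by
  have hsurj := KrullML.shiftHom_zero_surjective (lam := lam)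
  have hker := KrullML.ker_shiftHom_zero_ne_bot hlam
  have hth := KrullML.universalTheory_Glam_eq hlam
  refine ⟨⟨inferInstance, KrullML.isEquationallyNoetherian_Mlam hlam,
    ⟨.ofHom _ hsurj hker hth⟩, ?_⟩, ⟨KrullML.shiftHom lam 0, ?_, ?_, hsurj, hker, hth⟩,
    fun C => C.nonempty_mulEquiv hlam⟩
  · rintro n ⟨C⟩
    exact C.length_le_one hlam
  · exact (KrullML.shiftHom_zero_mkM KrullML.fa).trans (KrullML.homF_fa _ _)
  · exact (KrullML.shiftHom_zero_mkM KrullML.fb).trans (KrullML.homF_fb _ _)
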